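/- Let four smooth ($C^\infty$) $1$-forms, pairwise linearly independent at every point of an open set $U\subset\mathbb R^2$, define a planar $4$-web on $U$. Rescale them by nowhere vanishing smooth functions to forms $\omega_1,\dots,\omega_4$ with $$\omega_1+\omega_2+\omega_3=0,\qquad a\,\omega_1+\omega_2+\omega_4=0 .$$ Let $\partial_1,\partial_2$ be the frame dual to $\omega_1,\omega_2$, let $\gamma=g_1\omega_1+g_2\omega_2$ be the $1$-form with $d\omega_i=\omega_i\wedge\gamma$ ($i=1,2$), and let $d\gamma=K\,\omega_1\wedge\omega_2$. For a function $w$ of weight $k$ put $\delta_iw=\partial_iw-k\,g_i\,w$, a function of weight $k+1$. Let $a$ have weight $0$ and $K$ weight $2$; write $a_i=\delta_ia$, $a_{ij}=\delta_i\delta_ja$ (symmetric in $i,j$), $K_i=\delta_iK$, and let $a_{112},a_{122}$ be the components of the symmetrized third covariant derivative of $a$ (the means of $\delta_i\delta_j\delta_ka$ over the three orders of the indices). Put $$c_0=K+\frac{a_{11}-aa_{22}-2(1-a)a_{12}}{4a(1-a)}+\frac{(2a-1)a_1^2-a^2a_2^2+2(1-a)^2a_1a_2}{4(1-a)^2a^2},$$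 $$c_1=\frac{K_2-K_1}{4(1-a)}+\frac{(a-4)a_1+(11-20a+12a^2)a_2}{12(1-a)^2a}K+\frac{a_{112}-a_{122}}{4a(1-a)}+\frac{a_1-aa_2}{4a^2(1-a)}a_{22}+\frac{(2a-1)(a_1-aa_2)}{4(1-a)^2a^2}a_{12}-\frac{a_2^2((1-2a)a_1+aa_2)}{4(1-a)^2a^2},$$ $$c_2=\frac{aK_2-K_1}{4a(1-a)}+\frac{(1-2a)a_1-(a-2)aa_2}{4(1-a)^2a^2}K,$$ which have weights $2,3,3$, write $c_{i,j}=\delta_jc_i$, and let $$G_{11}=ac_0(c_{2,2}-c_{2,1})+ac_2(c_{0,1}-c_{0,2})-a(1-a)c_1c_2+(2a_2-a_1-aa_2)c_0c_2-Kc_0^2,$$ $$G_{12}=ac_0(c_{1,2}-c_{1,1})+ac_1(c_{0,1}-c_{0,2})-a(1-a)c_1^2+(2a_2-a_1-2aa_2)c_0c_1+(a_2^2+a_{12}-a_{22})c_0^2,$$ $$G_{21}=c_0(c_{2,1}-ac_{2,2})+c_2(ac_{0,2}-c_{0,1})-2a_2c_0c_2+a(1-a)c_2^2,$$ $$G_{22}=c_0(c_{1,1}-ac_{1,2})+c_1(ac_{0,2}-c_{0,1})+a(1-a)c_1c_2-a_2c_0c_1-a_2(1-a)c_0c_2+(a_{22}-K)c_0^2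 .$$ The rank of the web at $p\in U$ is the dimension of the space of germs at $p$ of smooth solutions $(\lambda_1,\dots,\lambda_4)$ of the abelian equation $\sum_i\lambda_i\omega_i=0$, $d(\lambda_i\omega_i)=0$ for $i=1,\dots,4$. Let $p\in U$. (i) Suppose that either $c_0(p)\ne0$ or $c_0$ vanishes identically near $p$. Then the web has rank two at $p$ if and only if $c_0(p)\neq 0$ and $G_{11}=G_{12}=G_{21}=G_{22}=0$ near $p$. (ii) Without any assumption on the zeros of $c_0$: if the web has rank two at $p$, then $c_0$ does not vanish identically near $p$, and $G_{11}=G_{12}=G_{21}=G_{22}=0$ near $p$. (iii) On every open $V\subset U$ on which $c_0$ has no zero, for smooth $u,v$ (of weight $1$), the functions $\lambda_1=u+av$, $\lambda_2=u+v$, $\lambda_3=u$, $\lambda_4=v$ solve the abelian equation on $V$ if and only if $$\delta_1u=\delta_2u=-\delta_1v=\frac{ac_1-a_2c_0}{c_0}v+\frac{ac_2}{c_0}u,\qquad \delta_2v=-\frac{c_1}{c_0}v-\frac{c_2}{c_0}u .$$ (iv) The $G_{ij}$ are the compatibility conditions of this system: writing it as $\delta_i\binom uv=M_i\binom uv$,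 $i=1,2$, one has, at every point where $c_0\ne0$, $$c_0^2\bigl(\delta_2M_1-\delta_1M_2+M_1M_2-M_2M_1-K\,I\bigr)=\begin{pmatrix}G_{11}&G_{12}\\G_{21}&G_{22}\end{pmatrix}$$ (entries of $M_1,M_2$ having weight $1$). -/

import Mathlib

open Filter Topology
open scoped ContDiff

noncomputable section

/-- The coordinate plane. -/
abbrev Plane : Type := ℝ × ℝ

/-- A differential `1`-form on the plane. -/
abbrev OneForm : Type := Plane → Plane →L[ℝ] ℝ

/-- The coefficient of `α ∧ β` with respect to `dx ∧ dy`. -/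
def wedge (α β : OneForm) (q : Plane) : ℝ :=
  α q (1, 0) * β q (0, 1) - α q (0, 1) * β q (1, 0)

/-- The coefficient of the exterior derivative `dα` with respect to `dx ∧ dy`. -/
def extD (α : OneForm) (q : Plane) : ℝ :=
  fderiv ℝ α q (1, 0) (0, 1) - fderiv ℝ α q (0, 1) (1, 0)

/-- A planar `4`-web on an open set `U`: four smooth `1`-forms that are pairwise independent at every
point of `U`; the leaves of the `i`-th foliation are the integral curves of the kernel of the `i`-th
form. -/
structure FourWeb (U : Set Plane) where
  isOpen : IsOpen U
  form : Fin 4 → OneForm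
  smooth : ∀ i, ContDiffOn ℝ ∞ (form i) U
  transverse : ∀ i j, i ≠ j → ∀ q ∈ U, wedge (form i) (form j) q ≠ 0

/-- The abelian equation for four `1`-forms on `V`: smooth functions `l 0, …, l 3` with
`∑ l i • θ i = 0` and with every `l i • θ i` closed. -/
def IsAbelianOn (θ : Fin 4 → OneForm) (l : Plane → Fin 4 → ℝ) (V : Set Plane) : Prop :=
  ContDiffOn ℝ ∞ l V ∧
    ∀ q ∈ V, (∑ i, l q i • θ i q = 0) ∧ ∀ i, extD (fun z => l z i • θ i z) q = 0

theorem extD_add {α β : OneForm} {q : Plane} (hα : DifferentiableAt ℝ α q)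
    (hβ : DifferentiableAt ℝ β q) :
    extD (fun z => α z + β z) q = extD α q + extD β q := by
  unfold extD
  rw [fderiv_fun_add hα hβ]
  simp only [add_apply]
  ring

theorem extD_const_smul {α : OneForm} {q : Plane} (c : ℝ) (hα : DifferentiableAt ℝ α q) :
    extD (fun z => c • α z) q = c * extD α q := by
  unfold extD
  rw [fderiv_fun_const_smul hα]
  simp only [smul_apply, smul_eq_mul]
  ring

namespace FourWeb

variable {U : Set Plane}

theorem differentiableAt_smul_form (W : FourWeb U) {l : Plane → Fin 4 → ℝ} {V : Set Plane}
    (hV : IsOpen V) (hVU : V ⊆ U) (hl : ContDiffOn ℝ ∞ l V) (i : Fin 4) {q : Plane} (hq : q ∈ V) :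
    DifferentiableAt ℝ (fun z => l z i • W.form i z) q := by
  have h1 : DifferentiableAt ℝ l q :=
    (hl.contDiffAt (hV.mem_nhds hq)).differentiableAt (by simp)
  have h2 : DifferentiableAt ℝ (W.form i) q :=
    ((W.smooth i).contDiffAt (W.isOpen.mem_nhds (hVU hq))).differentiableAt (by simp)
  exact (differentiableAt_pi.1 h1 i).smul h2

/-- The vector space of germs at `p` of solutions of the abelian equation of a web. -/
def abelianGerms (W : FourWeb U) (p : Plane) (hp : p ∈ U) :
    Submodule ℝ (Germ (𝓝 p) (Fin 4 → ℝ)) where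
  carrier := {φ | ∃ (l : Plane → Fin 4 → ℝ) (V : Set Plane), IsOpen V ∧ p ∈ V ∧ V ⊆ U ∧
    IsAbelianOn W.form l V ∧ (l : Germ (𝓝 p) (Fin 4 → ℝ)) = φ}
  zero_mem' := by
    refine ⟨0, U, W.isOpen, hp, subset_rfl, ⟨contDiffOn_const, fun q _ => ⟨by simp, fun i => ?_⟩⟩,
      rfl⟩
    simp [extD]
  add_mem' := by
    rintro _ _ ⟨l, V, hV, hpV, hVU, ⟨hl, hl'⟩, rfl⟩ ⟨m, V', hV', hpV', -, ⟨hm, hm'⟩, rfl⟩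
    have hl2 := hl.mono (Set.inter_subset_left : V ∩ V' ⊆ V)
    have hm2 := hm.mono (Set.inter_subset_right : V ∩ V' ⊆ V')
    have hO := hV.inter hV'
    have hOU : V ∩ V' ⊆ U := fun q hq => hVU hq.1
    refine ⟨l + m, V ∩ V', hO, ⟨hpV, hpV'⟩, hOU, ⟨hl2.add hm2, fun q hq => ⟨?_, fun i => ?_⟩⟩,
      rfl⟩
    · simp only [Pi.add_apply, add_smul, Finset.sum_add_distrib]
      rw [(hl' q hq.1).1, (hm' q hq.2).1, add_zero]
    · simp only [Pi.add_apply, add_smul]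
      rw [extD_add (W.differentiableAt_smul_form hO hOU hl2 i hq)
        (W.differentiableAt_smul_form hO hOU hm2 i hq), (hl' q hq.1).2 i, (hm' q hq.2).2 i,
        add_zero]
  smul_mem' := by
    rintro c _ ⟨l, V, hV, hpV, hVU, ⟨hl, hl'⟩, rfl⟩
    refine ⟨c • l, V, hV, hpV, hVU, ⟨hl.const_smul c, fun q hq => ⟨?_, fun i => ?_⟩⟩, rfl⟩
    · simp only [Pi.smul_apply, smul_assoc]
      rw [← Finset.smul_sum, (hl' q hq).1, smul_zero]
    · simp only [Pi.smul_apply, smul_assoc]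
      rw [extD_const_smul c (W.differentiableAt_smul_form hV hVU hl i hq), (hl' q hq).2 i, mul_zero]

/-- The rank of the web (near `p`): the dimension of the space of germs at `p` of solutions of the
abelian equation. -/
def rankAt (W : FourWeb U) (p : Plane) (hp : p ∈ U) : Cardinal :=
  Module.rank ℝ (W.abelianGerms p hp)

/-- A normalization of a `4`-web: defining forms `ω₁ = η 0, …, ω₄ = η 3` of the same foliations,
rescaled so that `η 0 + η 1 + η 2 = 0` and `a • η 0 + η 1 + η 3 = 0`. The function `a` is the basic
invariant of the web. -/
structure Normalization (W : FourWeb U) where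
  scale : Fin 4 → Plane → ℝ
  scale_smooth : ∀ i, ContDiffOn ℝ ∞ (scale i) U
  scale_ne_zero : ∀ i, ∀ q ∈ U, scale i q ≠ 0
  η : Fin 4 → OneForm
  η_eq : ∀ i, ∀ q ∈ U, η i q = scale i q • W.form i q
  a : Plane → ℝ
  sum_three : ∀ q ∈ U, η 0 q + η 1 q + η 2 q = 0
  sum_four : ∀ q ∈ U, a q • η 0 q + η 1 q + η 3 q = 0

namespace Normalization

variable {W : FourWeb U} (N : W.Normalization)

/-- `ω₁ ∧ ω₂`. -/
def vol (q : Plane) : ℝ := wedge (N.η 0) (N.η 1) q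

/-- The frame of vector fields `∂₁, ∂₂` dual to `ω₁, ω₂`. -/
def frame₁ (q : Plane) : Plane := (N.η 1 q (0, 1) / N.vol q, -N.η 1 q (1, 0) / N.vol q)

/-- The vector field `∂₂` of the dual frame. -/
def frame₂ (q : Plane) : Plane := (-N.η 0 q (0, 1) / N.vol q, N.η 0 q (1, 0) / N.vol q)

/-- The components of the Chern connection form `γ = g₁ ω₁ + g₂ ω₂`, that is, of the form with
`dω₁ = ω₁ ∧ γ` and `dω₂ = ω₂ ∧ γ`. -/
def g₁ (q : Plane) : ℝ := -extD (N.η 1) q / N.vol q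

/-- The second component of `γ`. -/
def g₂ (q : Plane) : ℝ := extD (N.η 0) q / N.vol q

/-- The Chern connection form. -/
def γ : OneForm := fun q => N.g₁ q • N.η 0 q + N.g₂ q • N.η 1 q

/-- The curvature function of the `3`-web `ω₁, ω₂, ω₃`: `dγ = K ω₁ ∧ ω₂`. -/
def K (q : Plane) : ℝ := extD N.γ q / N.vol q

/-- The first covariant derivative `δ₁ u = ∂₁ u - k g₁ u` of a function `u` of weight `k`; it is of
weight `k + 1`. -/
def δ₁ (k : ℕ) (u : Plane → ℝ) (q : Plane) : ℝ :=
  fderiv ℝ u q (N.frame₁ q) - k * N.g₁ q * u q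

/-- The second covariant derivative `δ₂ u = ∂₂ u - k g₂ u` of a function `u` of weight `k`; it is of
weight `k + 1`. -/
def δ₂ (k : ℕ) (u : Plane → ℝ) (q : Plane) : ℝ :=
  fderiv ℝ u q (N.frame₂ q) - k * N.g₂ q * u q

/-- The covariant derivatives of the basic invariant `a`, a function of weight `0`. -/
def a₁ : Plane → ℝ := N.δ₁ 0 N.a
def a₂ : Plane → ℝ := N.δ₂ 0 N.a
def a₁₁ : Plane → ℝ := N.δ₁ 1 N.a₁
def a₁₂ : Plane → ℝ := N.δ₁ 1 N.a₂
def a₂₂ : Plane → ℝ := N.δ₂ 1 N.a₂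

/-- Components of the symmetrized third covariant derivative of `a` (`δ₁` and `δ₂` do not commute on
functions of nonzero weight, while `δ₁ δ₂ a = δ₂ δ₁ a`). -/
def a₁₁₂ (q : Plane) : ℝ :=
  (N.δ₁ 2 (N.δ₁ 1 (N.δ₂ 0 N.a)) q + N.δ₁ 2 (N.δ₂ 1 (N.δ₁ 0 N.a)) q
    + N.δ₂ 2 (N.δ₁ 1 (N.δ₁ 0 N.a)) q) / 3

/-- See `a₁₁₂`. -/
def a₁₂₂ (q : Plane) : ℝ :=
  (N.δ₁ 2 (N.δ₂ 1 (N.δ₂ 0 N.a)) q + N.δ₂ 2 (N.δ₁ 1 (N.δ₂ 0 N.a)) q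
    + N.δ₂ 2 (N.δ₂ 1 (N.δ₁ 0 N.a)) q) / 3

/-- The covariant derivatives of the curvature function `K`, a function of weight `2`. -/
def K₁ : Plane → ℝ := N.δ₁ 2 N.K
def K₂ : Plane → ℝ := N.δ₂ 2 N.K

/-- The coefficient `c₀` of the obstruction `c₀ v₂ + c₁ v + c₂ u`; it has weight `2`. -/
def c₀ (q : Plane) : ℝ :=
  let a := N.a q; let a₁ := N.a₁ q; let a₂ := N.a₂ q
  N.K q + (N.a₁₁ q - a * N.a₂₂ q - 2 * (1 - a) * N.a₁₂ q) / (4 * a * (1 - a))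
    + ((-1 + 2 * a) * a₁ ^ 2 - a ^ 2 * a₂ ^ 2 + 2 * (1 - a) ^ 2 * a₁ * a₂)
      / (4 * (1 - a) ^ 2 * a ^ 2)

/-- The coefficient `c₁` of the obstruction `c₀ v₂ + c₁ v + c₂ u`; it has weight `3`. -/
def c₁ (q : Plane) : ℝ :=
  let a := N.a q; let a₁ := N.a₁ q; let a₂ := N.a₂ q
  (N.K₂ q - N.K₁ q) / (4 * (1 - a))
    + ((a - 4) * a₁ + (11 - 20 * a + 12 * a ^ 2) * a₂) / (12 * (1 - a) ^ 2 * a) * N.K q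
    + (N.a₁₁₂ q - N.a₁₂₂ q) / (4 * a * (1 - a))
    + (a₁ - a * a₂) / (4 * a ^ 2 * (1 - a)) * N.a₂₂ q
    + (2 * a - 1) * (a₁ - a * a₂) / (4 * (1 - a) ^ 2 * a ^ 2) * N.a₁₂ q
    - a₂ ^ 2 * ((1 - 2 * a) * a₁ + a * a₂) / (4 * (1 - a) ^ 2 * a ^ 2)

/-- The coefficient `c₂` of the obstruction `c₀ v₂ + c₁ v + c₂ u`; it has weight `3`. -/
def c₂ (q : Plane) : ℝ :=
  let a := N.a q; let a₁ := N.a₁ q; let a₂ := N.a₂ q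
  (a * N.K₂ q - N.K₁ q) / (4 * a * (1 - a))
    + ((1 - 2 * a) * a₁ - (a - 2) * a * a₂) / (4 * (1 - a) ^ 2 * a ^ 2) * N.K q

/-- The covariant derivatives `c_{i,j} = δ_j c_i`. -/
def c₀₁ : Plane → ℝ := N.δ₁ 2 N.c₀
def c₀₂ : Plane → ℝ := N.δ₂ 2 N.c₀
def c₁₁ : Plane → ℝ := N.δ₁ 3 N.c₁
def c₁₂ : Plane → ℝ := N.δ₂ 3 N.c₁
def c₂₁ : Plane → ℝ := N.δ₁ 3 N.c₂
def c₂₂ : Plane → ℝ := N.δ₂ 3 N.c₂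

/-- The invariant `G₁₁`. -/
def G₁₁ (q : Plane) : ℝ :=
  let a := N.a q; let a₁ := N.a₁ q; let a₂ := N.a₂ q
  let c₀ := N.c₀ q; let c₁ := N.c₁ q; let c₂ := N.c₂ q
  a * c₀ * (N.c₂₂ q - N.c₂₁ q) + a * c₂ * (N.c₀₁ q - N.c₀₂ q) - a * (1 - a) * c₁ * c₂
    + (2 * a₂ - a₁ - a * a₂) * c₀ * c₂ - N.K q * c₀ ^ 2

/-- The invariant `G₁₂`. -/
def G₁₂ (q : Plane) : ℝ :=
  let a := N.a q; let a₁ := N.a₁ q; let a₂ := N.a₂ q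
  let c₀ := N.c₀ q; let c₁ := N.c₁ q
  a * c₀ * (N.c₁₂ q - N.c₁₁ q) + a * c₁ * (N.c₀₁ q - N.c₀₂ q) - a * (1 - a) * c₁ ^ 2
    + (2 * a₂ - a₁ - 2 * a * a₂) * c₀ * c₁ + (a₂ ^ 2 + N.a₁₂ q - N.a₂₂ q) * c₀ ^ 2

/-- The invariant `G₂₁`. -/
def G₂₁ (q : Plane) : ℝ :=
  let a := N.a q; let a₂ := N.a₂ q; let c₀ := N.c₀ q; let c₂ := N.c₂ q
  c₀ * (N.c₂₁ q - a * N.c₂₂ q) + c₂ * (a * N.c₀₂ q - N.c₀₁ q) - 2 * a₂ * c₀ * c₂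
    + a * (1 - a) * c₂ ^ 2

/-- The invariant `G₂₂`. -/
def G₂₂ (q : Plane) : ℝ :=
  let a := N.a q; let a₂ := N.a₂ q
  let c₀ := N.c₀ q; let c₁ := N.c₁ q; let c₂ := N.c₂ q
  c₀ * (N.c₁₁ q - a * N.c₁₂ q) + c₁ * (a * N.c₀₂ q - N.c₀₁ q) + a * (1 - a) * c₁ * c₂
    - a₂ * c₀ * c₁ - a₂ * (1 - a) * c₀ * c₂ + (N.a₂₂ q - N.K q) * c₀ ^ 2

/-- All four invariants `G₁₁, G₁₂, G₂₁, G₂₂` vanish at `q`. -/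
def GVanish (q : Plane) : Prop :=
  N.G₁₁ q = 0 ∧ N.G₁₂ q = 0 ∧ N.G₂₁ q = 0 ∧ N.G₂₂ q = 0

/-- The solution `λ₁ = u + a v, λ₂ = u + v, λ₃ = u, λ₄ = v` of `λ₁ ω₁ + ⋯ + λ₄ ω₄ = 0` with
parameters `u` and `v`. -/
def multipliers (u v : Plane → ℝ) (q : Plane) : Fin 4 → ℝ :=
  ![u q + N.a q * v q, u q + v q, u q, v q]

/-- The coefficients of the first-order system `δ₁ (u, v) = M₁ (u, v)`, `δ₂ (u, v) = M₂ (u, v)`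
obtained from the abelian equation and `c₀ v₂ + c₁ v + c₂ u = 0` where `c₀ ≠ 0`. -/
def M₁ (q : Plane) : Matrix (Fin 2) (Fin 2) ℝ :=
  let a := N.a q; let a₂ := N.a₂ q; let c₀ := N.c₀ q; let c₁ := N.c₁ q; let c₂ := N.c₂ q
  !![a * c₂ / c₀, (a * c₁ - a₂ * c₀) / c₀;
     -(a * c₂ / c₀), (a₂ * c₀ - a * c₁) / c₀]

/-- The matrix `M₂` of the first-order system. -/
def M₂ (q : Plane) : Matrix (Fin 2) (Fin 2) ℝ :=
  let a := N.a q; let a₂ := N.a₂ q; let c₀ := N.c₀ q; let c₁ := N.c₁ q; let c₂ := N.c₂ q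
  !![a * c₂ / c₀, (a * c₁ - a₂ * c₀) / c₀;
     -(c₂ / c₀), -(c₁ / c₀)]

/-- The functions `u, v` of weight `1` solve the first-order system at `q`. -/
def SolvesAt (u v : Plane → ℝ) (q : Plane) : Prop :=
  N.δ₁ 1 u q = N.M₁ q 0 0 * u q + N.M₁ q 0 1 * v q ∧
  N.δ₂ 1 u q = N.M₂ q 0 0 * u q + N.M₂ q 0 1 * v q ∧
  N.δ₁ 1 v q = N.M₁ q 1 0 * u q + N.M₁ q 1 1 * v q ∧
  N.δ₂ 1 v q = N.M₂ q 1 0 * u q + N.M₂ q 1 1 * v q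

/-- The compatibility matrix `δ₂ M₁ - δ₁ M₂ + M₁ M₂ - M₂ M₁ - K` of the first-order system: by the
commutation relation `δ₂ δ₁ w - δ₁ δ₂ w = K w` for functions of weight `1`, the integrability
condition of the system is that this matrix vanishes. -/
def compat (q : Plane) : Matrix (Fin 2) (Fin 2) ℝ :=
  Matrix.of (fun i j => N.δ₂ 1 (fun z => N.M₁ z i j) q - N.δ₁ 1 (fun z => N.M₂ z i j) q)
    + (N.M₁ q * N.M₂ q - N.M₂ q * N.M₁ q) - N.K q • (1 : Matrix (Fin 2) (Fin 2) ℝ)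

end Normalization

/-- Every `4`-web has a normalization. -/
theorem exists_normalization (W : FourWeb U) : Nonempty W.Normalization := by
  have hsm : ∀ i (v : Plane), ContDiffOn ℝ ∞ (fun q => W.form i q v) U := fun i v =>
    (W.smooth i).clm_apply contDiffOn_const
  have hw : ∀ i j, ContDiffOn ℝ ∞ (fun q => wedge (W.form i) (W.form j) q) U := fun i j =>
    ((hsm i _).mul (hsm j _)).sub ((hsm i _).mul (hsm j _))
  let w : Fin 4 → Fin 4 → Plane → ℝ := fun i j q => wedge (W.form i) (W.form j) q
  have hne : ∀ i j, i ≠ j → ∀ q ∈ U, w i j q ≠ 0 := W.transverse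
  let s : Fin 4 → Plane → ℝ := ![w 1 2, w 2 0, w 0 1, fun q => w 2 0 q * w 0 1 q / w 0 3 q * (-1)]
  refine ⟨⟨s, ?_, ?_, fun i q => s i q • W.form i q, fun i q _ => rfl,
    fun q => w 3 1 q * w 2 0 q / (w 1 2 q * w 0 3 q), ?_, ?_⟩⟩
  · intro i
    fin_cases i
    · exact hw 1 2
    · exact hw 2 0
    · exact hw 0 1
    · exact ((((hw 2 0).mul (hw 0 1)).div (hw 0 3) (hne 0 3 (by decide))).mul contDiffOn_const)
  · intro i q hq
    fin_cases i
    · exact hne 1 2 (by decide) q hq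
    · exact hne 2 0 (by decide) q hq
    · exact hne 0 1 (by decide) q hq
    · exact mul_ne_zero (div_ne_zero (mul_ne_zero (hne 2 0 (by decide) q hq)
        (hne 0 1 (by decide) q hq)) (hne 0 3 (by decide) q hq)) (by norm_num)
  · intro q hq
    apply ContinuousLinearMap.ext
    rintro ⟨x, y⟩
    have hxy : ((x, y) : Plane) = x • ((1, 0) : Plane) + y • ((0, 1) : Plane) := by simp
    rw [hxy]
    simp [s, w, wedge, -Prod.smul_mk, -Prod.mk_add_mk]
    ring
  · intro q hq
    apply ContinuousLinearMap.ext
    rintro ⟨x, y⟩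
    have hxy : ((x, y) : Plane) = x • ((1, 0) : Plane) + y • ((0, 1) : Plane) := by simp
    have h1 := hne 1 2 (by decide) q hq
    have h2 := hne 0 3 (by decide) q hq
    rw [hxy]
    simp [s, -Prod.smul_mk, -Prod.mk_add_mk]
    field_simp
    simp only [w, wedge]
    ring

end FourWeb

end

/-! A relation between the four forms is parametrized by two functions `u`, `v` of weight 1, and
closedness of the four summands amounts to three first-order equations, `δ₁ u = δ₂ u = -δ₁ v = -(a w
+ a₂ v)` with `w = δ₂ v`, because the four closedness conditions add up to zero. The only free first
derivative is `w`. The commutation relation `δ₂ δ₁ - δ₁ δ₂ = k K` on weight `k`, applied to `u` and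
to `v`, gives two linear equations for `δ₁ w` and `δ₂ w` whose determinant is nonzero because `a`
avoids 0 and 1. So the abelian equation prolongs to a total linear system for `(u, v, w)`, and a
solution is determined near a point by these three values there. The commutator on `w` is the only
condition left; it fails by `-4 (c₀ w + c₁ v + c₂ u)` (`jet_comm_w`), so this expression vanishes on
every solution.

Where `c₀ ≠ 0` the obstruction expresses `w` through `u` and `v`, and the abelian equation becomes
the total system with matrices `M₁`, `M₂`. Its solutions are determined by `(u, v)` at a point,
hence the rank is at most two (`rankAt_le_two`). If the compatibility matrix, which is `G` divided
by `c₀ ^ 2`, vanishes nearby, the system is flat and every initial value is attained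
(`two_le_rankAt`).

For necessity, two independent solutions have independent jets `(u, v, w)` at every point of a ball.
Where `c₀ ≠ 0` the pairs `(u, v)` are then independent, and the compatibility matrix annihilates
them, so it is zero. At interior points of the zero set of `c₀`, differentiating `c₁ v + c₂ u = 0`
forces `c₁ = c₂ = 0` (`c₁_c₂_eq_zero_of_independent`), and every term of each `Gᵢⱼ` contains some
`cᵢ`. The remaining points follow by continuity. If `c₀` vanished identically near `p`, then so
would `c₁` and `c₂`, the prolonged system would be flat, and the rank would be at least three
(`three_le_rankAt`).

The analytic input is a Frobenius theorem for linear systems `∂ₓ Z = A Z`, `∂ᵧ Z = B Z` in the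
plane: existence under flatness, smoothness, and uniqueness on convex sets.
`systemAt_iff_hasFDerivAt` transports it to covariant systems. -/

section LinearSystems

/-! ### Flat linear systems in the plane: existence, smoothness, uniqueness. -/

open Set MeasureTheory

variable {E : Type*} [NormedAddCommGroup E] [NormedSpace ℝ E]

/-- The retraction of the line onto `[-r, r]`. -/
def clampTo (r x : ℝ) : ℝ := max (-r) (min x r)

theorem continuous_clampTo (r : ℝ) : Continuous (clampTo r) := by
  unfold clampTo; fun_prop

theorem abs_clampTo_le {r : ℝ} (hr : 0 ≤ r) (x : ℝ) : |clampTo r x| ≤ r := by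
  unfold clampTo
  rw [abs_le]
  exact ⟨le_max_left _ _, max_le (by linarith) (min_le_right _ _)⟩

theorem clampTo_of_abs_le {r x : ℝ} (hx : |x| ≤ r) : clampTo r x = x := by
  rw [abs_le] at hx
  unfold clampTo
  rw [min_eq_left hx.2, max_eq_right hx.1]

theorem norm_intervalIntegral_zero_le {f : ℝ → E} {x r M : ℝ} (hx : |x| ≤ r) (hM : 0 ≤ M)
    (hf : ∀ s, ‖f s‖ ≤ M) : ‖∫ s in (0 : ℝ)..x, f s‖ ≤ r * M := by
  have h := intervalIntegral.norm_integral_le_of_norm_le_const (a := (0 : ℝ)) (b := x) (f := f)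
    (C := M) (fun s _ => hf s)
  rw [sub_zero] at h
  nlinarith

variable [CompleteSpace E]

/-- A Volterra-type integral equation on a small square. -/
theorem exists_continuous_integral_solution {A B : ℝ × ℝ → E →L[ℝ] E} (hA : Continuous A)
    (hB : Continuous B) {C r : ℝ} (hr : 0 ≤ r) (hAC : ∀ q, ‖A q‖ ≤ C) (hBC : ∀ q, ‖B q‖ ≤ C)
    (hCr : r * C ≤ 1 / 4) (z : E) :
    ∃ Y : ℝ × ℝ → E, Continuous Y ∧ ∀ x y, |x| ≤ r → |y| ≤ r →
      Y (x, y) = z + (∫ s in (0 : ℝ)..x, A (s, 0) (Y (s, 0)))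
        + ∫ t in (0 : ℝ)..y, B (x, t) (Y (x, t)) := by
  have hC : 0 ≤ C := (norm_nonneg _).trans (hAC 0)
  -- Clamping the endpoints, and the first argument in the second integral, keeps the operator
  -- bounded on functions on the whole plane; on the square of radius `r` the clamps are the
  -- identity.
  let L : (ℝ × ℝ → E) → ℝ × ℝ → E := fun Y q =>
    (∫ s in (0 : ℝ)..clampTo r q.1, A (s, 0) (Y (s, 0)))
      + ∫ t in (0 : ℝ)..clampTo r q.2, B (clampTo r q.1, t) (Y (clampTo r q.1, t))
  have hcl := continuous_clampTo r
  have hLc : ∀ Y : ℝ × ℝ → E, Continuous Y → Continuous (L Y) := by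
    intro Y hY
    refine Continuous.add ?_ ?_
    · refine intervalIntegral.continuous_parametric_intervalIntegral_of_continuous ?_
        (hcl.comp continuous_fst)
      unfold Function.uncurry
      fun_prop
    · refine intervalIntegral.continuous_parametric_intervalIntegral_of_continuous ?_
        (hcl.comp continuous_snd)
      unfold Function.uncurry
      fun_prop
  -- Each of the two integrals contributes at most `r * C * M ≤ M / 4`, which gives the contraction
  -- constant `1 / 2`.
  have hLb : ∀ (Y : ℝ × ℝ → E) (M : ℝ), (∀ q, ‖Y q‖ ≤ M) → ∀ q, ‖L Y q‖ ≤ 1 / 2 * M := by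
    intro Y M hM q
    have hM0 : 0 ≤ M := (norm_nonneg _).trans (hM 0)
    have h1 : ‖∫ s in (0 : ℝ)..clampTo r q.1, A (s, 0) (Y (s, 0))‖ ≤ r * (C * M) :=
      norm_intervalIntegral_zero_le (abs_clampTo_le hr _) (by positivity) fun s =>
        ((A _).le_opNorm _).trans (mul_le_mul (hAC _) (hM _) (norm_nonneg _) hC)
    have h2 : ‖∫ t in (0 : ℝ)..clampTo r q.2, B (clampTo r q.1, t) (Y (clampTo r q.1, t))‖
        ≤ r * (C * M) :=
      norm_intervalIntegral_zero_le (abs_clampTo_le hr _) (by positivity) fun s =>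
        ((B _).le_opNorm _).trans (mul_le_mul (hBC _) (hM _) (norm_nonneg _) hC)
    have h3 := norm_add_le (∫ s in (0 : ℝ)..clampTo r q.1, A (s, 0) (Y (s, 0)))
      (∫ t in (0 : ℝ)..clampTo r q.2, B (clampTo r q.1, t) (Y (clampTo r q.1, t)))
    have h4 : r * C * M ≤ 1 / 4 * M := mul_le_mul_of_nonneg_right hCr hM0
    have h5 : ‖L Y q‖ ≤ _ := h3
    linarith
  have hLsub : ∀ Y Y' : ℝ × ℝ → E, Continuous Y → Continuous Y' → ∀ q,
      L Y q - L Y' q = L (fun q => Y q - Y' q) q := by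
    intro Y Y' hY hY' q
    simp only [L, map_sub]
    rw [intervalIntegral.integral_sub, intervalIntegral.integral_sub]
    · abel
    all_goals
      apply Continuous.intervalIntegrable
      fun_prop
  let T : BoundedContinuousFunction (ℝ × ℝ) E → BoundedContinuousFunction (ℝ × ℝ) E := fun Y =>
    BoundedContinuousFunction.ofNormedAddCommGroup (fun q => z + L Y q)
      (continuous_const.add (hLc Y Y.continuous)) (‖z‖ + 1 / 2 * ‖Y‖) fun q =>
        (norm_add_le _ _).trans (by gcongr; exact hLb Y _ Y.norm_coe_le_norm q)
  have hT : ContractingWith (1 / 2) T := by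
    refine ⟨by norm_num, LipschitzWith.of_dist_le_mul fun Y Y' => ?_⟩
    rw [BoundedContinuousFunction.dist_le (by positivity)]
    intro q
    change dist (z + L Y q) (z + L Y' q) ≤ _
    rw [dist_add_left, dist_eq_norm, hLsub Y Y' Y.continuous Y'.continuous]
    have h := hLb (fun q => Y q - Y' q) (dist Y Y') (fun q => by
      rw [← dist_eq_norm]
      exact BoundedContinuousFunction.dist_coe_le_dist q) q
    simpa using h
  let Y := ContractingWith.fixedPoint T hT
  have hY : T Y = Y := hT.fixedPoint_isFixedPt
  refine ⟨Y, Y.continuous, fun x y hx hy => ?_⟩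
  have h := DFunLike.congr_fun hY (x, y)
  rw [← h]
  change z + L Y (x, y) = _
  simp only [L, clampTo_of_abs_le hx, clampTo_of_abs_le hy]
  abel

/-- A flat linear system on a square, with coefficients extended continuously to the whole plane,
has a solution with partial derivatives. -/
theorem exists_partial_solution_of_flat {A B A' B' : ℝ × ℝ → E →L[ℝ] E} (hA : Continuous A)
    (hB : Continuous B) (hA' : Continuous A') (hB' : Continuous B') {C r : ℝ} (hr : 0 < r)
    (hAC : ∀ q, ‖A q‖ ≤ C) (hBC : ∀ q, ‖B q‖ ≤ C) (hB'C : ∀ q, ‖B' q‖ ≤ C) (hCr : r * C ≤ 1 / 4)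
    (hr1 : r ≤ 1)
    (hdA : ∀ x y, |x| < r → |y| < r → HasDerivAt (fun t => A (x, t)) (A' (x, y)) y)
    (hdB : ∀ x y, |x| < r → |y| < r → HasDerivAt (fun s => B (s, y)) (B' (x, y)) x)
    (flat : ∀ x y, |x| < r → |y| < r →
      A' (x, y) + (A (x, y)).comp (B (x, y)) = B' (x, y) + (B (x, y)).comp (A (x, y))) (z : E) :
    ∃ Y : ℝ × ℝ → E, Continuous Y ∧ Y 0 = z ∧ ∀ x y, |x| < r → |y| < r →
      HasDerivAt (fun s => Y (s, y)) (A (x, y) (Y (x, y))) x ∧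
      HasDerivAt (fun t => Y (x, t)) (B (x, y) (Y (x, y))) y := by
  have hC : 0 ≤ C := (norm_nonneg _).trans (hAC 0)
  obtain ⟨Y, hYc, hY⟩ := exists_continuous_integral_solution hA hB hr.le hAC hBC hCr z
  have hYy : ∀ x y, |x| < r → |y| < r →
      HasDerivAt (fun t => Y (x, t)) (B (x, y) (Y (x, y))) y := by
    intro x y hx hy
    have hc : Continuous fun t => B (x, t) (Y (x, t)) := by fun_prop
    have h := ((hc.integral_hasStrictDerivAt 0 y).hasDerivAt).const_add
      (z + ∫ s in (0 : ℝ)..x, A (s, 0) (Y (s, 0)))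
    refine h.congr_of_eventuallyEq ?_
    filter_upwards [(isOpen_lt continuous_abs continuous_const).mem_nhds hy] with t ht
    exact hY x t hx.le (le_of_lt ht)
  -- The integral equation gives the `y`-equation for `Y` at once. `F` integrates the `x`-equation
  -- instead, starting from the axis `x = 0`; it remains to show `Y = F`.
  let F : ℝ × ℝ → E := fun q => Y (0, q.2) + ∫ s in (0 : ℝ)..q.1, A (s, q.2) (Y (s, q.2))
  have hFc : Continuous F := by
    refine Continuous.add (by fun_prop) ?_
    refine intervalIntegral.continuous_parametric_intervalIntegral_of_continuous ?_ continuous_fst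
    unfold Function.uncurry
    fun_prop
  have hFx : ∀ x y, HasDerivAt (fun s => F (s, y)) (A (x, y) (Y (x, y))) x := by
    intro x y
    have hc : Continuous fun s => A (s, y) (Y (s, y)) := by fun_prop
    exact ((hc.integral_hasStrictDerivAt 0 x).hasDerivAt).const_add (Y (0, y))
  have hF0 : ∀ x, |x| < r → F (x, 0) = Y (x, 0) := by
    intro x hx
    have h0 : |(0 : ℝ)| ≤ r := by simpa using hr.le
    simp only [F]
    rw [hY x 0 hx.le h0, hY 0 0 h0 h0]
    simp
  have hFy : ∀ x y, |x| < r → |y| < r → HasDerivAt (fun t => F (x, t))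
      (B (x, y) (F (x, y)) + ∫ s in (0 : ℝ)..x, B' (s, y) (Y (s, y) - F (s, y))) y := by
    intro x y hx hy
    have hsx : ∀ s ∈ uIcc 0 x, |s| < r := by
      intro s hs
      have := abs_sub_left_of_mem_uIcc hs
      simp only [sub_zero] at this
      exact this.trans_lt hx
    have hbd : ∃ M, ∀ s ∈ uIcc 0 x, ∀ t ∈ Icc (-r) r,
        ‖A' (s, t) (Y (s, t)) + A (s, t) (B (s, t) (Y (s, t)))‖ ≤ M := by
      have hK : IsCompact (uIcc 0 x ×ˢ Icc (-r) r) := isCompact_uIcc.prod isCompact_Icc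
      have hcc : Continuous fun q : ℝ × ℝ => A' q (Y q) + A q (B q (Y q)) := by fun_prop
      obtain ⟨M, hM⟩ := hK.exists_bound_of_continuousOn hcc.continuousOn
      exact ⟨M, fun s hs t ht => hM (s, t) ⟨hs, ht⟩⟩
    obtain ⟨M, hM⟩ := hbd
    have hlt : ∀ t ∈ Ioo (-r) r, |t| < r := fun t ht => abs_lt.2 ht
    have h1 := (intervalIntegral.hasDerivAt_integral_of_dominated_loc_of_deriv_le
      (μ := volume) (a := 0) (b := x) (F := fun t s => A (s, t) (Y (s, t)))
      (F' := fun t s => A' (s, t) (Y (s, t)) + A (s, t) (B (s, t) (Y (s, t))))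
      (x₀ := y) (s := Ioo (-r) r) (bound := fun _ => M) (isOpen_Ioo.mem_nhds (abs_lt.1 hy))
      (Eventually.of_forall fun t => Continuous.aestronglyMeasurable (by fun_prop))
      (Continuous.intervalIntegrable (by fun_prop) _ _)
      (Continuous.aestronglyMeasurable (by fun_prop))
      (Eventually.of_forall fun s hs t ht =>
        hM s (uIoc_subset_uIcc hs) t (Ioo_subset_Icc_self ht))
      intervalIntegrable_const
      (Eventually.of_forall fun s hs t ht =>
        (hdA s t (hsx s (uIoc_subset_uIcc hs)) (hlt t ht)).clm_apply
          (hYy s t (hsx s (uIoc_subset_uIcc hs)) (hlt t ht)))).2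
    have h2 := (hYy 0 y (by simpa using hr) hy).add h1
    refine h2.congr_deriv ?_
    -- Flatness turns `A' Y + A B Y` into `B' Y + B A Y`. With `B' F` in place of `B' Y` this is the
    -- `x`-derivative of `B F`, so only the integral of `B' (Y - F)` survives.
    have h3 : (∫ s in (0 : ℝ)..x, B' (s, y) (F (s, y)) + B (s, y) (A (s, y) (Y (s, y))))
        = B (x, y) (F (x, y)) - B (0, y) (F (0, y)) := by
      refine intervalIntegral.integral_eq_sub_of_hasDerivAt
        (f := fun s => B (s, y) (F (s, y))) (fun s hs => ?_)
        (Continuous.intervalIntegrable (by fun_prop) _ _)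
      exact (hdB s y (hsx s hs) hy).clm_apply (hFx s y)
    have h4 : (∫ s in (0 : ℝ)..x, A' (s, y) (Y (s, y)) + A (s, y) (B (s, y) (Y (s, y))))
        = (∫ s in (0 : ℝ)..x, B' (s, y) (F (s, y)) + B (s, y) (A (s, y) (Y (s, y))))
          + ∫ s in (0 : ℝ)..x, B' (s, y) (Y (s, y) - F (s, y)) := by
      rw [← intervalIntegral.integral_add]
      · refine intervalIntegral.integral_congr fun s hs => ?_
        have := DFunLike.congr_fun (flat s y (hsx s hs) hy) (Y (s, y))
        simp only [add_apply, ContinuousLinearMap.comp_apply] at this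
        simp only [map_sub, this]
        abel
      all_goals exact Continuous.intervalIntegrable (by fun_prop) _ _
    have h5 : F (0, y) = Y (0, y) := by simp [F]
    rw [h4, h3, h5]
    abel
  -- The difference `D = Y - F` vanishes on `y = 0` and satisfies `∂ᵧ D = B D - ∫ B' D`. On a
  -- slightly smaller closed square its maximum `m` therefore satisfies `m ≤ 2 C m r ≤ m / 2`.
  have hD : ∀ x y, |x| < r → |y| < r → Y (x, y) = F (x, y) := by
    intro x y hx hy
    obtain ⟨ρ, hρ, hρr⟩ := exists_between (max_lt hx hy)
    have hρ0 : 0 ≤ ρ := (abs_nonneg x).trans ((le_max_left _ _).trans hρ.le)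
    have hmem : ∀ {a : ℝ}, a ∈ Icc (-ρ) ρ → |a| < r := fun ha =>
      (abs_le.2 ha).trans_lt hρr
    have hK : IsCompact (Icc (-ρ) ρ ×ˢ Icc (-ρ) ρ) := isCompact_Icc.prod isCompact_Icc
    have hne : (x, y) ∈ Icc (-ρ) ρ ×ˢ Icc (-ρ) ρ :=
      ⟨abs_le.1 ((le_max_left _ _).trans hρ.le), abs_le.1 ((le_max_right _ _).trans hρ.le)⟩
    obtain ⟨⟨x₀, y₀⟩, ⟨hx₀, hy₀⟩, hmax⟩ := hK.exists_isMaxOn ⟨_, hne⟩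
      ((hYc.sub hFc).norm.continuousOn)
    set m := ‖(Y - F) (x₀, y₀)‖ with hm
    have hm0 : 0 ≤ m := norm_nonneg _
    have hle : ∀ a ∈ Icc (-ρ) ρ, ∀ b ∈ Icc (-ρ) ρ, ‖Y (a, b) - F (a, b)‖ ≤ m :=
      fun a ha b hb => hmax (a := (a, b)) ⟨ha, hb⟩
    have h0 : (0 : ℝ) ∈ Icc (-ρ) ρ := ⟨by linarith, hρ0⟩
    have hder : ∀ b ∈ Icc (-ρ) ρ, HasDerivWithinAt (fun t => Y (x₀, t) - F (x₀, t))
        (B (x₀, b) (Y (x₀, b)) - (B (x₀, b) (F (x₀, b))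
          + ∫ s in (0 : ℝ)..x₀, B' (s, b) (Y (s, b) - F (s, b)))) (Icc (-ρ) ρ) b := fun b hb =>
      ((hYy x₀ b (hmem hx₀) (hmem hb)).sub (hFy x₀ b (hmem hx₀) (hmem hb))).hasDerivWithinAt
    have hbound : ∀ b ∈ Icc (-ρ) ρ, ‖B (x₀, b) (Y (x₀, b)) - (B (x₀, b) (F (x₀, b))
          + ∫ s in (0 : ℝ)..x₀, B' (s, b) (Y (s, b) - F (s, b)))‖ ≤ 2 * (C * m) := by
      intro b hb
      have e1 : ‖B (x₀, b) (Y (x₀, b) - F (x₀, b))‖ ≤ C * m :=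
        ((B _).le_opNorm _).trans (mul_le_mul (hBC _) (hle x₀ hx₀ b hb) (norm_nonneg _) hC)
      have e2 : ‖∫ s in (0 : ℝ)..x₀, B' (s, b) (Y (s, b) - F (s, b))‖ ≤ C * m * |x₀ - 0| := by
        refine intervalIntegral.norm_integral_le_of_norm_le_const fun s hs => ?_
        have hs' : s ∈ Icc (-ρ) ρ := by
          have h1 := abs_sub_left_of_mem_uIcc (uIoc_subset_uIcc hs)
          simp only [sub_zero] at h1
          exact abs_le.1 (h1.trans (abs_le.2 hx₀))
        exact ((B' _).le_opNorm _).trans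
          (mul_le_mul (hB'C _) (hle s hs' b hb) (norm_nonneg _) hC)
      -- Here `r ≤ 1` is needed, to bound the integral term by `C * m` as well.
      have e3 : |x₀ - 0| ≤ 1 := by
        rw [sub_zero]; exact (hmem hx₀).le.trans hr1
      have e4 : C * m * |x₀ - 0| ≤ C * m * 1 := by gcongr
      rw [← sub_sub, ← map_sub]
      exact (norm_sub_le _ _).trans (by linarith)
    have hmv := (convex_Icc (-ρ) ρ).norm_image_sub_le_of_norm_hasDerivWithin_le hder hbound h0 hy₀
    simp only [hF0 x₀ (hmem hx₀), sub_self, sub_zero] at hmv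
    have e5 : ‖y₀‖ ≤ r := (hmem hy₀).le
    have e6 : m ≤ 2 * (C * m) * r := hmv.trans (by gcongr)
    have e7 : r * C * m ≤ 1 / 4 * m := mul_le_mul_of_nonneg_right hCr hm0
    have e8 : m = 0 := by nlinarith
    have e9 := hle x hne.1 y hne.2
    rw [e8] at e9
    exact sub_eq_zero.1 (norm_le_zero_iff.1 e9)
  refine ⟨Y, hYc, ?_, fun x y hx hy => ⟨?_, hYy x y hx hy⟩⟩
  · have h0 : |(0 : ℝ)| ≤ r := by simpa using hr.le
    have := hY 0 0 h0 h0
    change Y (0, 0) = z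
    simpa using this
  · refine (hFx x y).congr_of_eventuallyEq ?_
    filter_upwards [(isOpen_lt continuous_abs continuous_const).mem_nhds hx] with s hs
    exact hD s y hs hy

/-- Existence of solutions of flat linear systems of first-order equations in the plane. -/
theorem exists_hasFDerivAt_of_flat {A B : ℝ × ℝ → E →L[ℝ] E} {V : Set (ℝ × ℝ)} {p : ℝ × ℝ}
    (hV : IsOpen V) (hp : p ∈ V) (hA : ContDiffOn ℝ ∞ A V) (hB : ContDiffOn ℝ ∞ B V)
    (flat : ∀ q ∈ V, fderiv ℝ A q (0, 1) + (A q).comp (B q)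
      = fderiv ℝ B q (1, 0) + (B q).comp (A q)) (z : E) :
    ∃ (Z : ℝ × ℝ → E) (O : Set (ℝ × ℝ)), IsOpen O ∧ p ∈ O ∧ O ⊆ V ∧ Z p = z ∧ ∀ q ∈ O,
      HasFDerivAt Z ((ContinuousLinearMap.fst ℝ ℝ ℝ).smulRight (A q (Z q))
        + (ContinuousLinearMap.snd ℝ ℝ ℝ).smulRight (B q (Z q))) q := by
  obtain ⟨x₀, y₀⟩ := p
  obtain ⟨R, hR, hRV⟩ := Metric.nhds_basis_closedBall.mem_iff.1 (hV.mem_nhds hp)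
  have hcpt : IsCompact (Metric.closedBall ((x₀, y₀) : ℝ × ℝ) R) := isCompact_closedBall _ _
  have hfA : ContinuousOn (fun q => fderiv ℝ A q (0, 1)) V :=
    (hA.continuousOn_fderiv_of_isOpen hV (by simp)).clm_apply continuousOn_const
  have hfB : ContinuousOn (fun q => fderiv ℝ B q (1, 0)) V :=
    (hB.continuousOn_fderiv_of_isOpen hV (by simp)).clm_apply continuousOn_const
  obtain ⟨C₁, h₁⟩ := hcpt.exists_bound_of_continuousOn (hA.continuousOn.mono hRV)
  obtain ⟨C₂, h₂⟩ := hcpt.exists_bound_of_continuousOn (hB.continuousOn.mono hRV)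
  obtain ⟨C₄, h₄⟩ := hcpt.exists_bound_of_continuousOn (hfB.mono hRV)
  -- The 1 makes `C` positive, so that `1 / (4 * C)` is a legitimate radius. The `y`-derivative of
  -- `A` needs no bound: it is used only through flatness.
  let C := max 1 (max (max C₁ C₂) C₄)
  have hC : 0 < C := lt_of_lt_of_le one_pos (le_max_left _ _)
  let r := min (min R 1) (1 / (4 * C))
  have hr : 0 < r := lt_min (lt_min hR one_pos) (by positivity)
  have hrR : r ≤ R := (min_le_left _ _).trans (min_le_left _ _)
  have hr1 : r ≤ 1 := (min_le_left _ _).trans (min_le_right _ _)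
  have hCr : r * C ≤ 1 / 4 := by
    have : r * C ≤ 1 / (4 * C) * C := mul_le_mul_of_nonneg_right (min_le_right _ _) hC.le
    refine this.trans (le_of_eq ?_)
    field_simp
  -- Composing with this retraction extends the coefficients to bounded continuous functions on the
  -- whole plane, centred at the origin and unchanged on the small square.
  let κ : ℝ × ℝ → ℝ × ℝ := fun q => (x₀ + clampTo r q.1, y₀ + clampTo r q.2)
  have hκc : Continuous κ := by
    have := continuous_clampTo r
    fun_prop
  have hκm : ∀ q, κ q ∈ Metric.closedBall ((x₀, y₀) : ℝ × ℝ) R := by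
    intro q
    rw [Metric.mem_closedBall, Prod.dist_eq, max_le_iff]
    simp only [κ, Real.dist_eq, add_sub_cancel_left]
    exact ⟨(abs_clampTo_le hr.le _).trans hrR, (abs_clampTo_le hr.le _).trans hrR⟩
  have hκe : ∀ x y, |x| < r → |y| < r → κ (x, y) = (x₀ + x, y₀ + y) := by
    intro x y hx hy
    simp only [κ, clampTo_of_abs_le hx.le, clampTo_of_abs_le hy.le]
  have hcomp : ∀ f : ℝ × ℝ → E →L[ℝ] E, ContinuousOn f V → Continuous (f ∘ κ) := fun f hf =>
    hf.comp_continuous hκc fun q => hRV (hκm q)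
  have hmemV : ∀ x y, |x| < r → |y| < r → ((x₀ + x, y₀ + y) : ℝ × ℝ) ∈ V := by
    intro x y hx hy
    rw [← hκe x y hx hy]
    exact hRV (hκm _)
  have hevx : ∀ x, |x| < r → ∀ᶠ s in 𝓝 x, |s| < r := fun x hx =>
    (isOpen_lt continuous_abs continuous_const).mem_nhds hx
  have hdA : ∀ q ∈ V, HasFDerivAt A (fderiv ℝ A q) q := fun q hq =>
    ((hA.contDiffAt (hV.mem_nhds hq)).differentiableAt (by simp)).hasFDerivAt
  have hdB : ∀ q ∈ V, HasFDerivAt B (fderiv ℝ B q) q := fun q hq =>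
    ((hB.contDiffAt (hV.mem_nhds hq)).differentiableAt (by simp)).hasFDerivAt
  obtain ⟨Y, hYc, hY0, hY⟩ := exists_partial_solution_of_flat (C := C)
    (hcomp A hA.continuousOn) (hcomp B hB.continuousOn) (hcomp _ hfA) (hcomp _ hfB) hr
    (fun q => (h₁ _ (hκm q)).trans (by simp [C]))
    (fun q => (h₂ _ (hκm q)).trans (by simp [C]))
    (fun q => (h₄ _ (hκm q)).trans (by simp [C])) hCr hr1
    (by
      intro x y hx hy
      have h := (hdA _ (hmemV x y hx hy)).comp_hasDerivAt y
        (((hasDerivAt_const y (x₀ + x)).prodMk ((hasDerivAt_id y).const_add y₀)))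
      simp only [Function.comp_apply, hκe x y hx hy]
      refine h.congr_of_eventuallyEq ?_
      filter_upwards [hevx y hy] with t ht
      simp [hκe x t hx ht])
    (by
      intro x y hx hy
      have h := (hdB _ (hmemV x y hx hy)).comp_hasDerivAt x
        ((((hasDerivAt_id x).const_add x₀).prodMk (hasDerivAt_const x (y₀ + y))))
      simp only [Function.comp_apply, hκe x y hx hy]
      refine h.congr_of_eventuallyEq ?_
      filter_upwards [hevx x hx] with s hs
      simp [hκe s y hs hy])
    (by
      intro x y hx hy
      simp only [Function.comp_apply, hκe x y hx hy]
      exact flat _ (hmemV x y hx hy)) z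
  have hS : IsOpen {q : ℝ × ℝ | |q.1| < r ∧ |q.2| < r} :=
    (isOpen_lt (continuous_abs.comp continuous_fst) continuous_const).inter
      (isOpen_lt (continuous_abs.comp continuous_snd) continuous_const)
  have hYd : ∀ q : ℝ × ℝ, |q.1| < r → |q.2| < r →
      HasFDerivAt Y ((ContinuousLinearMap.fst ℝ ℝ ℝ).smulRight (A (κ q) (Y q))
        + (ContinuousLinearMap.snd ℝ ℝ ℝ).smulRight (B (κ q) (Y q))) q := by
    intro q hq1 hq2
    have hAc := hcomp A hA.continuousOn
    have hBc := hcomp B hB.continuousOn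
    have hev : ∀ᶠ v in 𝓝 q, |v.1| < r ∧ |v.2| < r := hS.mem_nhds ⟨hq1, hq2⟩
    -- The partial derivatives exist near `q` and are continuous, which yields the total derivative.
    have h := (hasStrictFDerivAt_uncurry_coprod (𝕜 := ℝ) (u := q) (f := fun x y => Y (x, y))
      (f₁ := fun x y => ContinuousLinearMap.toSpanSingleton ℝ ((A ∘ κ) (x, y) (Y (x, y))))
      (f₂ := fun x y => ContinuousLinearMap.toSpanSingleton ℝ ((B ∘ κ) (x, y) (Y (x, y))))
      (hev.mono fun v hv => (hY v.1 v.2 hv.1 hv.2).1.hasFDerivAt)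
      (hev.mono fun v hv => (hY v.1 v.2 hv.1 hv.2).2.hasFDerivAt)
      (by
        apply Continuous.continuousAt
        have : Continuous fun x => ContinuousLinearMap.toSpanSingleton ℝ ((A ∘ κ) x (Y x)) :=
          (ContinuousLinearMap.toSpanSingletonCLE (𝕜 := ℝ) (E := E)).continuous.comp
            (hAc.clm_apply hYc)
        exact this)
      (by
        apply Continuous.continuousAt
        have : Continuous fun x => ContinuousLinearMap.toSpanSingleton ℝ ((B ∘ κ) x (Y x)) :=
          (ContinuousLinearMap.toSpanSingletonCLE (𝕜 := ℝ) (E := E)).continuous.comp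
            (hBc.clm_apply hYc)
        exact this)).hasFDerivAt
    have h' : HasFDerivAt Y
        ((ContinuousLinearMap.toSpanSingleton ℝ (A (κ q) (Y q))).coprod
          (ContinuousLinearMap.toSpanSingleton ℝ (B (κ q) (Y q)))) q := h
    refine h'.congr_fderiv ?_
    ext <;> simp
  let σ : ℝ × ℝ → ℝ × ℝ := fun q => q - (x₀, y₀)
  have hσ : Continuous σ := by fun_prop
  refine ⟨Y ∘ σ, σ ⁻¹' {q : ℝ × ℝ | |q.1| < r ∧ |q.2| < r}, hS.preimage hσ, ?_, ?_, ?_, ?_⟩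
  · simp [σ, hr]
  · rintro q ⟨h1, h2⟩
    have := hmemV _ _ h1 h2
    simpa [σ] using this
  · simp [σ, hY0]
  · rintro q ⟨h1, h2⟩
    have h := (hYd (σ q) h1 h2).comp q ((hasFDerivAt_id q).sub_const (x₀, y₀))
    have e : κ (σ q) = q := by
      have h := hκe _ _ h1 h2
      change κ (σ q) = _ at h
      rw [h]
      ext <;> simp [σ]
    rw [e] at h
    simpa using h

omit [CompleteSpace E] in
/-- Solutions of first-order linear systems with smooth coefficients are smooth. -/
theorem contDiffOn_of_hasFDerivAt {A B : ℝ × ℝ → E →L[ℝ] E} {V : Set (ℝ × ℝ)}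
    (hV : IsOpen V) (hA : ContDiffOn ℝ ∞ A V) (hB : ContDiffOn ℝ ∞ B V) {Z : ℝ × ℝ → E}
    (hZ : ∀ q ∈ V, HasFDerivAt Z ((ContinuousLinearMap.fst ℝ ℝ ℝ).smulRight (A q (Z q))
        + (ContinuousLinearMap.snd ℝ ℝ ℝ).smulRight (B q (Z q))) q) : ContDiffOn ℝ ∞ Z V := by
  rw [contDiffOn_infty]
  intro n
  induction n with
  | zero =>
    exact contDiffOn_zero.2 fun q hq => (hZ q hq).continuousAt.continuousWithinAt
  | succ n ih =>
    push_cast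
    rw [contDiffOn_succ_iff_fderiv_of_isOpen hV]
    refine ⟨fun q hq => (hZ q hq).differentiableAt.differentiableWithinAt, by simp, ?_⟩
    have hA' : ContDiffOn ℝ n A V := hA.of_le (mod_cast le_top)
    have hB' : ContDiffOn ℝ n B V := hB.of_le (mod_cast le_top)
    have : ContDiffOn ℝ n (fun q => (ContinuousLinearMap.fst ℝ ℝ ℝ).smulRight (A q (Z q))
        + (ContinuousLinearMap.snd ℝ ℝ ℝ).smulRight (B q (Z q))) V :=
      (contDiffOn_const.smulRight (hA'.clm_apply ih)).add
        (contDiffOn_const.smulRight (hB'.clm_apply ih))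
    exact this.congr fun q hq => (hZ q hq).fderiv

omit [CompleteSpace E] in
/-- A solution of a first-order linear system on a convex open set that vanishes at a point
vanishes identically. -/
theorem eq_zero_of_hasFDerivAt_of_convex {A B : ℝ × ℝ → E →L[ℝ] E} {V : Set (ℝ × ℝ)}
    (hVc : Convex ℝ V) (hA : ContinuousOn A V) (hB : ContinuousOn B V)
    {Z : ℝ × ℝ → E}
    (hZ : ∀ q ∈ V, HasFDerivAt Z ((ContinuousLinearMap.fst ℝ ℝ ℝ).smulRight (A q (Z q))
        + (ContinuousLinearMap.snd ℝ ℝ ℝ).smulRight (B q (Z q))) q)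
    {p : ℝ × ℝ} (hp : p ∈ V) (hZp : Z p = 0) : ∀ q ∈ V, Z q = 0 := by
  intro q hq
  let c : ℝ → ℝ × ℝ := fun t => p + t • (q - p)
  have hc : ∀ t ∈ Icc (0 : ℝ) 1, c t ∈ V := fun t ht => hVc.add_smul_sub_mem hp hq ht
  have hcc : Continuous c := by fun_prop
  have hcd : ∀ t, HasDerivAt c (q - p) t := fun t =>
    (((hasDerivAt_id t).smul_const (q - p)).const_add p).congr_deriv (by simp)
  let S : ℝ → E →L[ℝ] E := fun t => (q - p).1 • A (c t) + (q - p).2 • B (c t)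
  have hA' : ContinuousOn (fun t => A (c t)) (Icc 0 1) := hA.comp hcc.continuousOn hc
  have hB' : ContinuousOn (fun t => B (c t)) (Icc 0 1) := hB.comp hcc.continuousOn hc
  have hS : ContinuousOn S (Icc 0 1) := by
    refine ContinuousOn.add ?_ ?_
    · exact ContinuousOn.const_smul hA' (q - p).1
    · exact ContinuousOn.const_smul hB' (q - p).2
  obtain ⟨M, hM⟩ := isCompact_Icc.exists_bound_of_continuousOn hS
  have hd : ∀ t ∈ Icc (0 : ℝ) 1, HasDerivAt (Z ∘ c) (S t (Z (c t))) t := by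
    intro t ht
    have h := (hZ _ (hc t ht)).comp_hasDerivAt t (hcd t)
    simpa [S] using h
  have hb : ∀ t ∈ Icc (0 : ℝ) 1, ‖S t (Z (c t))‖ ≤ M * ‖Z (c t)‖ := fun t ht =>
    ((S t).le_opNorm _).trans (mul_le_mul_of_nonneg_right (hM t ht) (norm_nonneg _))
  have hc0 : (Z ∘ c) 0 = 0 := by simp [c, hZp]
  -- Grönwall along the segment from `p` to `q`; convexity keeps the segment inside `V`.
  have h := eq_zero_of_abs_deriv_le_mul_abs_self_of_eq_zero_right (f := Z ∘ c)
    (f' := fun t => S t (Z (c t))) (K := M) (a := 0) (b := 1)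
    (fun t ht => (hd t ht).continuousAt.continuousWithinAt)
    (fun t ht => (hd t (Ico_subset_Icc_self ht)).hasDerivWithinAt)
    hc0
    (fun t ht => hb t (Ico_subset_Icc_self ht)) 1 (right_mem_Icc.2 zero_le_one)
  have hc1 : c 1 = q := by simp [c]
  rw [← hc1]
  exact h

end LinearSystems

/-! ### Calculus of forms and covectors in coordinates. -/

theorem extD_congr {α β : OneForm} {q : Plane} (h : α =ᶠ[𝓝 q] β) : extD α q = extD β q := by
  unfold extD
  rw [h.fderiv_eq]

theorem extD_smul {f : Plane → ℝ} {α : OneForm} {q : Plane} (hf : DifferentiableAt ℝ f q)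
    (hα : DifferentiableAt ℝ α q) :
    extD (fun z => f z • α z) q = fderiv ℝ f q (1, 0) * α q (0, 1)
      - fderiv ℝ f q (0, 1) * α q (1, 0) + f q * extD α q := by
  unfold extD
  rw [fderiv_fun_smul hf hα]
  simp
  ring

theorem ContDiffOn.extD {α : OneForm} {V : Set Plane} (hV : IsOpen V)
    (hα : ContDiffOn ℝ ∞ α V) : ContDiffOn ℝ ∞ (extD α) V := by
  have h : ContDiffOn ℝ ∞ (fderiv ℝ α) V := hα.fderiv_of_isOpen hV (by simp)
  exact ((h.clm_apply contDiffOn_const).clm_apply contDiffOn_const).sub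
    ((h.clm_apply contDiffOn_const).clm_apply contDiffOn_const)

theorem ContDiffOn.wedge {α β : OneForm} {V : Set Plane} (hα : ContDiffOn ℝ ∞ α V)
    (hβ : ContDiffOn ℝ ∞ β V) : ContDiffOn ℝ ∞ (wedge α β) V :=
  ((hα.clm_apply contDiffOn_const).mul (hβ.clm_apply contDiffOn_const)).sub
    ((hα.clm_apply contDiffOn_const).mul (hβ.clm_apply contDiffOn_const))

theorem ContDiffOn.differentiableAt_of_isOpen {F : Type*} [NormedAddCommGroup F] [NormedSpace ℝ F]
    {f : Plane → F} {V : Set Plane} (hf : ContDiffOn ℝ ∞ f V) (hV : IsOpen V) {q : Plane}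
    (hq : q ∈ V) : DifferentiableAt ℝ f q :=
  (hf.contDiffAt (hV.mem_nhds hq)).differentiableAt (by simp)

/-- A covector on the plane is determined by its values on the coordinate vectors. -/
theorem clm_plane_apply (φ : Plane →L[ℝ] ℝ) (x : Plane) :
    φ x = x.1 * φ (1, 0) + x.2 * φ (0, 1) := by
  have h : x = x.1 • ((1, 0) : Plane) + x.2 • ((0, 1) : Plane) := by simp
  conv_lhs => rw [h]
  rw [map_add, map_smul, map_smul, smul_eq_mul, smul_eq_mul]

theorem clm_plane_ext {φ ψ : Plane →L[ℝ] ℝ} (h₁ : φ (1, 0) = ψ (1, 0))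
    (h₂ : φ (0, 1) = ψ (0, 1)) : φ = ψ := by
  ext
  · simpa using h₁
  · simpa using h₂

/-! ### The adapted frame, weights and the commutation of covariant derivatives. -/

namespace FourWeb.Normalization

variable {U : Set Plane} {W : FourWeb U} (N : W.Normalization)

theorem η_smooth (i : Fin 4) : ContDiffOn ℝ ∞ (N.η i) U :=
  ((N.scale_smooth i).smul (W.smooth i)).congr (N.η_eq i)

theorem wedge_η_ne_zero {i j : Fin 4} (hij : i ≠ j) {q : Plane} (hq : q ∈ U) :
    wedge (N.η i) (N.η j) q ≠ 0 := by
  have h : wedge (N.η i) (N.η j) q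
      = N.scale i q * N.scale j q * wedge (W.form i) (W.form j) q := by
    unfold wedge
    rw [N.η_eq i q hq, N.η_eq j q hq]
    simp only [smul_apply, smul_eq_mul]
    ring
  rw [h]
  exact mul_ne_zero (mul_ne_zero (N.scale_ne_zero i q hq) (N.scale_ne_zero j q hq))
    (W.transverse i j hij q hq)

theorem vol_ne_zero {q : Plane} (hq : q ∈ U) : N.vol q ≠ 0 :=
  N.wedge_η_ne_zero (by decide) hq

theorem η_two_eq {q : Plane} (hq : q ∈ U) : N.η 2 q = -N.η 0 q - N.η 1 q := by
  rw [← sub_eq_zero, ← N.sum_three q hq]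
  abel

theorem η_three_eq {q : Plane} (hq : q ∈ U) : N.η 3 q = -(N.a q • N.η 0 q) - N.η 1 q := by
  rw [← sub_eq_zero, ← N.sum_four q hq]
  abel

theorem a_ne_zero {q : Plane} (hq : q ∈ U) : N.a q ≠ 0 := by
  intro h
  apply N.wedge_η_ne_zero (i := 1) (j := 3) (by decide) hq
  simp only [wedge, N.η_three_eq hq, h]
  simp
  ring

theorem a_ne_one {q : Plane} (hq : q ∈ U) : N.a q ≠ 1 := by
  intro h
  apply N.wedge_η_ne_zero (i := 2) (j := 3) (by decide) hq
  simp only [wedge, N.η_three_eq hq, N.η_two_eq hq, h]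
  simp
  ring

theorem one_sub_a_ne_zero {q : Plane} (hq : q ∈ U) : 1 - N.a q ≠ 0 :=
  sub_ne_zero.2 (N.a_ne_one hq).symm

theorem vol_smooth : ContDiffOn ℝ ∞ N.vol U := (N.η_smooth 0).wedge (N.η_smooth 1)

theorem a_smooth : ContDiffOn ℝ ∞ N.a U := by
  have h : ContDiffOn ℝ ∞ (fun q => wedge (N.η 1) (N.η 3) q / N.vol q) U :=
    ((N.η_smooth 1).wedge (N.η_smooth 3)).div N.vol_smooth fun _ hq => N.vol_ne_zero hq
  refine h.congr fun q hq => ?_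
  rw [eq_div_iff (N.vol_ne_zero hq)]
  simp only [vol, wedge, N.η_three_eq hq]
  simp
  ring

theorem frame₁_smooth : ContDiffOn ℝ ∞ N.frame₁ U :=
  (((N.η_smooth 1).clm_apply contDiffOn_const).div N.vol_smooth
    fun _ hq => N.vol_ne_zero hq).prodMk
  (((N.η_smooth 1).clm_apply contDiffOn_const).neg.div N.vol_smooth fun _ hq => N.vol_ne_zero hq)

theorem frame₂_smooth : ContDiffOn ℝ ∞ N.frame₂ U :=
  (((N.η_smooth 0).clm_apply contDiffOn_const).neg.div N.vol_smooth
    fun _ hq => N.vol_ne_zero hq).prodMk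
  (((N.η_smooth 0).clm_apply contDiffOn_const).div N.vol_smooth fun _ hq => N.vol_ne_zero hq)

theorem g₁_smooth : ContDiffOn ℝ ∞ N.g₁ U :=
  ((N.η_smooth 1).extD W.isOpen).neg.div N.vol_smooth fun _ hq => N.vol_ne_zero hq

theorem g₂_smooth : ContDiffOn ℝ ∞ N.g₂ U :=
  ((N.η_smooth 0).extD W.isOpen).div N.vol_smooth fun _ hq => N.vol_ne_zero hq

theorem γ_smooth : ContDiffOn ℝ ∞ N.γ U :=
  (N.g₁_smooth.smul (N.η_smooth 0)).add (N.g₂_smooth.smul (N.η_smooth 1))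

theorem K_smooth : ContDiffOn ℝ ∞ N.K U :=
  (N.γ_smooth.extD W.isOpen).div N.vol_smooth fun _ hq => N.vol_ne_zero hq

theorem δ₁_smooth {u : Plane → ℝ} {V : Set Plane} (hV : IsOpen V) (hVU : V ⊆ U) (k : ℕ)
    (hu : ContDiffOn ℝ ∞ u V) : ContDiffOn ℝ ∞ (N.δ₁ k u) V :=
  ((hu.fderiv_of_isOpen hV (by simp)).clm_apply (N.frame₁_smooth.mono hVU)).sub
    ((contDiffOn_const.mul (N.g₁_smooth.mono hVU)).mul hu)

theorem δ₂_smooth {u : Plane → ℝ} {V : Set Plane} (hV : IsOpen V) (hVU : V ⊆ U) (k : ℕ)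
    (hu : ContDiffOn ℝ ∞ u V) : ContDiffOn ℝ ∞ (N.δ₂ k u) V :=
  ((hu.fderiv_of_isOpen hV (by simp)).clm_apply (N.frame₂_smooth.mono hVU)).sub
    ((contDiffOn_const.mul (N.g₂_smooth.mono hVU)).mul hu)

theorem η_zero_frame₁ {q : Plane} (hq : q ∈ U) : N.η 0 q (N.frame₁ q) = 1 := by
  have h := N.vol_ne_zero hq
  rw [clm_plane_apply]
  simp only [frame₁]
  field_simp
  simp only [vol, wedge]
  ring

theorem η_one_frame₁ {q : Plane} : N.η 1 q (N.frame₁ q) = 0 := by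
  rw [clm_plane_apply]
  simp only [frame₁]
  ring

theorem η_zero_frame₂ {q : Plane} : N.η 0 q (N.frame₂ q) = 0 := by
  rw [clm_plane_apply]
  simp only [frame₂]
  ring

theorem η_one_frame₂ {q : Plane} (hq : q ∈ U) : N.η 1 q (N.frame₂ q) = 1 := by
  have h := N.vol_ne_zero hq
  rw [clm_plane_apply]
  simp only [frame₂]
  field_simp
  simp only [vol, wedge]
  ring

theorem clm_eq_frame {q : Plane} (hq : q ∈ U) (φ : Plane →L[ℝ] ℝ) :
    φ = φ (N.frame₁ q) • N.η 0 q + φ (N.frame₂ q) • N.η 1 q := by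
  have h := N.vol_ne_zero hq
  have e : N.vol q = N.η 0 q (1, 0) * N.η 1 q (0, 1) - N.η 0 q (0, 1) * N.η 1 q (1, 0) := rfl
  apply clm_plane_ext
  · rw [clm_plane_apply φ (N.frame₁ q), clm_plane_apply φ (N.frame₂ q)]
    simp only [frame₁, frame₂, add_apply, smul_apply, smul_eq_mul]
    field_simp
    rw [e]
    ring
  · rw [clm_plane_apply φ (N.frame₁ q), clm_plane_apply φ (N.frame₂ q)]
    simp only [frame₁, frame₂, add_apply, smul_apply, smul_eq_mul]
    field_simp
    rw [e]
    ring

/-- The weight correction in `δᵢ` is exactly compensated by the `γ` term, so any `k` may be chosen.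
This is the passage from ordinary to covariant derivatives. -/
theorem fderiv_eq_frame {q : Plane} (hq : q ∈ U) (f : Plane → ℝ) (k : ℕ) :
    fderiv ℝ f q = N.δ₁ k f q • N.η 0 q + N.δ₂ k f q • N.η 1 q + (k * f q) • N.γ q := by
  conv_lhs => rw [N.clm_eq_frame hq (fderiv ℝ f q)]
  apply clm_plane_ext <;>
  · simp only [add_apply, smul_apply, smul_eq_mul, γ, δ₁, δ₂]
    ring

/-- Since `dωᵢ = ωᵢ ∧ γ`, the coefficients of a form in the coframe behave as functions of weight 1,
and closedness becomes a covariant equation. -/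
theorem extD_combination {q : Plane} (hq : q ∈ U) {f₁ f₂ : Plane → ℝ}
    (h₁ : DifferentiableAt ℝ f₁ q) (h₂ : DifferentiableAt ℝ f₂ q) :
    extD (fun z => f₁ z • N.η 0 z + f₂ z • N.η 1 z) q
      = (N.δ₁ 1 f₂ q - N.δ₂ 1 f₁ q) * N.vol q := by
  have hv := N.vol_ne_zero hq
  have hη := fun i => (N.η_smooth i).differentiableAt_of_isOpen W.isOpen hq
  have e : N.vol q = N.η 0 q (1, 0) * N.η 1 q (0, 1) - N.η 0 q (0, 1) * N.η 1 q (1, 0) := rfl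
  rw [extD_add (h₁.fun_smul (hη 0)) (h₂.fun_smul (hη 1)), extD_smul h₁ (hη 0), extD_smul h₂ (hη 1),
    N.clm_eq_frame hq (fderiv ℝ f₁ q), N.clm_eq_frame hq (fderiv ℝ f₂ q)]
  simp only [add_apply, smul_apply, smul_eq_mul, δ₁, δ₂, g₁, g₂]
  field_simp
  rw [e]
  ring

/-- The exterior derivative of the covariant form of a total differential. -/
theorem extD_covariant {q : Plane} (hq : q ∈ U) (k : ℕ) {f f₁ f₂ : Plane → ℝ}
    (hf : DifferentiableAt ℝ f q) (h₁ : DifferentiableAt ℝ f₁ q) (h₂ : DifferentiableAt ℝ f₂ q)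
    (e₁ : N.δ₁ k f q = f₁ q) (e₂ : N.δ₂ k f q = f₂ q) :
    extD (fun z => f₁ z • N.η 0 z + f₂ z • N.η 1 z + (k * f z) • N.γ z) q
      = (N.δ₁ (k + 1) f₂ q - N.δ₂ (k + 1) f₁ q + k * N.K q * f q) * N.vol q := by
  have hη := fun i => (N.η_smooth i).differentiableAt_of_isOpen W.isOpen hq
  have hγ := N.γ_smooth.differentiableAt_of_isOpen W.isOpen hq
  have e : N.vol q = N.η 0 q (1, 0) * N.η 1 q (0, 1) - N.η 0 q (0, 1) * N.η 1 q (1, 0) := rfl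
  have eK : extD N.γ q = N.K q * N.vol q := by
    rw [K, div_mul_cancel₀ _ (N.vol_ne_zero hq)]
  rw [extD_add ((h₁.fun_smul (hη 0)).fun_add (h₂.fun_smul (hη 1)))
      ((hf.const_mul (k : ℝ)).fun_smul hγ),
    N.extD_combination hq h₁ h₂, extD_smul (hf.const_mul _) hγ, fderiv_const_mul hf,
    N.fderiv_eq_frame hq f k, e₁, e₂, eK, e]
  simp only [add_apply, smul_apply, smul_eq_mul, δ₁, δ₂, γ]
  push_cast
  ring

/-- The commutation relation of the covariant derivatives. -/
theorem δ_comm {V : Set Plane} (hV : IsOpen V) (hVU : V ⊆ U) {w : Plane → ℝ}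
    (hw : ContDiffOn ℝ ∞ w V) (k : ℕ) {q : Plane} (hq : q ∈ V) :
    N.δ₂ (k + 1) (N.δ₁ k w) q - N.δ₁ (k + 1) (N.δ₂ k w) q = k * N.K q * w q := by
  have h := N.extD_covariant (hVU hq) k (f := w) (f₁ := N.δ₁ k w) (f₂ := N.δ₂ k w)
    (hw.differentiableAt_of_isOpen hV hq)
    ((N.δ₁_smooth hV hVU k hw).differentiableAt_of_isOpen hV hq)
    ((N.δ₂_smooth hV hVU k hw).differentiableAt_of_isOpen hV hq) rfl rfl
  -- This is `d (dw) = 0`; expanded covariantly it is the commutation relation times the volume.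
  have h0 : extD (fun z => fderiv ℝ w z) q = 0 := by
    have hs : IsSymmSndFDerivAt ℝ w q :=
      (hw.contDiffAt (hV.mem_nhds hq)).isSymmSndFDerivAt (by simp; exact WithTop.coe_le_coe.2 le_top)
    unfold extD
    rw [hs.eq, sub_self]
  have hc : (fun z => fderiv ℝ w z) =ᶠ[𝓝 q] fun z =>
      N.δ₁ k w z • N.η 0 z + N.δ₂ k w z • N.η 1 z + (k * w z) • N.γ z := by
    filter_upwards [hV.mem_nhds hq] with z hz
    exact N.fderiv_eq_frame (hVU hz) w k
  rw [extD_congr hc, h] at h0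
  have := (mul_eq_zero.1 h0).resolve_right (N.vol_ne_zero (hVU hq))
  linarith

/-- A function of weight `k`, differentiable at `q`, with given covariant derivatives at `q`. -/
def HasCovAt (k : ℕ) (u : Plane → ℝ) (d₁ d₂ : ℝ) (q : Plane) : Prop :=
  DifferentiableAt ℝ u q ∧ N.δ₁ k u q = d₁ ∧ N.δ₂ k u q = d₂

section HasCovAt

variable {N} {k l : ℕ} {u v : Plane → ℝ} {d₁ d₂ e₁ e₂ : ℝ} {q : Plane}

theorem HasCovAt.intro (hu : DifferentiableAt ℝ u q) :
    N.HasCovAt k u (N.δ₁ k u q) (N.δ₂ k u q) q := ⟨hu, rfl, rfl⟩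

theorem HasCovAt.congr_cov (h : N.HasCovAt k u d₁ d₂ q) (h₁ : d₁ = e₁) (h₂ : d₂ = e₂) :
    N.HasCovAt k u e₁ e₂ q := h₁ ▸ h₂ ▸ h

theorem HasCovAt.const (c : ℝ) : N.HasCovAt 0 (fun _ => c) 0 0 q := by
  refine ⟨by fun_prop, ?_, ?_⟩ <;> simp [δ₁, δ₂]

theorem HasCovAt.neg (hu : N.HasCovAt k u d₁ d₂ q) :
    N.HasCovAt k (fun z => -u z) (-d₁) (-d₂) q := by
  obtain ⟨h, rfl, rfl⟩ := hu
  refine ⟨h.neg, ?_, ?_⟩ <;> simp only [δ₁, δ₂, fderiv_fun_neg, neg_apply] <;> ring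

theorem HasCovAt.add (hu : N.HasCovAt k u d₁ d₂ q) (hv : N.HasCovAt k v e₁ e₂ q) :
    N.HasCovAt k (fun z => u z + v z) (d₁ + e₁) (d₂ + e₂) q := by
  obtain ⟨h, rfl, rfl⟩ := hu
  obtain ⟨h', rfl, rfl⟩ := hv
  refine ⟨h.add h', ?_, ?_⟩ <;>
    simp only [δ₁, δ₂, fderiv_fun_add h h', add_apply] <;> ring

theorem HasCovAt.sub (hu : N.HasCovAt k u d₁ d₂ q) (hv : N.HasCovAt k v e₁ e₂ q) :
    N.HasCovAt k (fun z => u z - v z) (d₁ - e₁) (d₂ - e₂) q := by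
  obtain ⟨h, rfl, rfl⟩ := hu
  obtain ⟨h', rfl, rfl⟩ := hv
  refine ⟨h.sub h', ?_, ?_⟩ <;>
    simp only [δ₁, δ₂, fderiv_fun_sub h h', sub_apply] <;> ring

theorem HasCovAt.mul (hu : N.HasCovAt k u d₁ d₂ q) (hv : N.HasCovAt l v e₁ e₂ q) :
    N.HasCovAt (k + l) (fun z => u z * v z) (d₁ * v q + u q * e₁) (d₂ * v q + u q * e₂) q := by
  obtain ⟨h, rfl, rfl⟩ := hu
  obtain ⟨h', rfl, rfl⟩ := hv
  refine ⟨h.mul h', ?_, ?_⟩ <;>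
  · simp only [δ₁, δ₂, fderiv_fun_mul h h', add_apply, smul_apply, smul_eq_mul]
    push_cast
    ring

theorem HasCovAt.div (hu : N.HasCovAt (k + l) u d₁ d₂ q) (hv : N.HasCovAt l v e₁ e₂ q)
    (h0 : v q ≠ 0) :
    N.HasCovAt k (fun z => u z / v z) ((d₁ * v q - u q * e₁) / v q ^ 2)
      ((d₂ * v q - u q * e₂) / v q ^ 2) q := by
  obtain ⟨h, rfl, rfl⟩ := hu
  obtain ⟨h', rfl, rfl⟩ := hv
  have hd : HasFDerivAt (fun z => u z / v z) _ q :=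
    h.hasFDerivAt.fun_mul ((hasDerivAt_inv h0).comp_hasFDerivAt q h'.hasFDerivAt)
  refine ⟨hd.differentiableAt, ?_, ?_⟩ <;>
  · simp only [δ₁, δ₂, hd.fderiv, add_apply, smul_apply, smul_eq_mul]
    push_cast
    field_simp
    ring

end HasCovAt

end FourWeb.Normalization

/-! ### Smoothness of the invariants, the prolonged system and its obstruction. -/

namespace FourWeb.Normalization

variable {U : Set Plane} {W : FourWeb U} (N : W.Normalization)

theorem HasCovAt.congr_of_eventuallyEq {N : W.Normalization} {k : ℕ} {u v : Plane → ℝ}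
    {d₁ d₂ : ℝ} {q : Plane} (h : N.HasCovAt k u d₁ d₂ q) (huv : v =ᶠ[𝓝 q] u) :
    N.HasCovAt k v d₁ d₂ q := by
  obtain ⟨hd, rfl, rfl⟩ := h
  refine ⟨hd.congr_of_eventuallyEq huv, ?_, ?_⟩ <;>
    simp only [δ₁, δ₂, huv.fderiv_eq, huv.eq_of_nhds]

theorem hasCovAt_of_smooth {u : Plane → ℝ} {V : Set Plane} (hV : IsOpen V)
    (hu : ContDiffOn ℝ ∞ u V) (k : ℕ) {q : Plane} (hq : q ∈ V) :
    N.HasCovAt k u (N.δ₁ k u q) (N.δ₂ k u q) q :=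
  .intro (hu.differentiableAt_of_isOpen hV hq)

theorem δ_smooth {u : Plane → ℝ} (k : ℕ) (hu : ContDiffOn ℝ ∞ u U) :
    ContDiffOn ℝ ∞ (N.δ₁ k u) U ∧ ContDiffOn ℝ ∞ (N.δ₂ k u) U :=
  ⟨N.δ₁_smooth W.isOpen subset_rfl k hu, N.δ₂_smooth W.isOpen subset_rfl k hu⟩

theorem a₁_smooth : ContDiffOn ℝ ∞ N.a₁ U := (N.δ_smooth 0 N.a_smooth).1
theorem a₂_smooth : ContDiffOn ℝ ∞ N.a₂ U := (N.δ_smooth 0 N.a_smooth).2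
theorem a₁₁_smooth : ContDiffOn ℝ ∞ N.a₁₁ U := (N.δ_smooth 1 N.a₁_smooth).1
theorem a₁₂_smooth : ContDiffOn ℝ ∞ N.a₁₂ U := (N.δ_smooth 1 N.a₂_smooth).1
theorem a₂₂_smooth : ContDiffOn ℝ ∞ N.a₂₂ U := (N.δ_smooth 1 N.a₂_smooth).2
theorem K₁_smooth : ContDiffOn ℝ ∞ N.K₁ U := (N.δ_smooth 2 N.K_smooth).1
theorem K₂_smooth : ContDiffOn ℝ ∞ N.K₂ U := (N.δ_smooth 2 N.K_smooth).2

theorem a₁₁₂_smooth : ContDiffOn ℝ ∞ N.a₁₁₂ U :=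
  (((N.δ_smooth 2 N.a₁₂_smooth).1.add
    (N.δ_smooth 2 (N.δ_smooth 1 N.a₁_smooth).2).1).add
    (N.δ_smooth 2 N.a₁₁_smooth).2).div_const 3

theorem a₁₂₂_smooth : ContDiffOn ℝ ∞ N.a₁₂₂ U :=
  (((N.δ_smooth 2 N.a₂₂_smooth).1.add (N.δ_smooth 2 N.a₁₂_smooth).2).add
    (N.δ_smooth 2 (N.δ_smooth 1 N.a₁_smooth).2).2).div_const 3

theorem c₀_smooth : ContDiffOn ℝ ∞ N.c₀ U := by
  have ha := N.a_smooth
  have h1 := N.a₁_smooth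
  have h2 := N.a₂_smooth
  have h11 := N.a₁₁_smooth
  have h12 := N.a₁₂_smooth
  have h22 := N.a₂₂_smooth
  have hK := N.K_smooth
  unfold c₀
  refine (hK.add (ContDiffOn.div (by fun_prop) (by fun_prop) fun q hq => ?_)).add
    (ContDiffOn.div (by fun_prop) (by fun_prop) fun q hq => ?_)
  all_goals
    have := N.a_ne_zero hq
    have := N.one_sub_a_ne_zero hq
    positivity

theorem c₁_smooth : ContDiffOn ℝ ∞ N.c₁ U := by
  have ha := N.a_smooth
  have h1 := N.a₁_smooth
  have h2 := N.a₂_smooth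
  have h12 := N.a₁₂_smooth
  have h22 := N.a₂₂_smooth
  have h112 := N.a₁₁₂_smooth
  have h122 := N.a₁₂₂_smooth
  have hK := N.K_smooth
  have hK1 := N.K₁_smooth
  have hK2 := N.K₂_smooth
  unfold c₁
  refine (((((ContDiffOn.div (by fun_prop) (by fun_prop) fun q hq => ?_).add
    (.mul (.div (by fun_prop) (by fun_prop) fun q hq => ?_) hK)).add
    (.div (by fun_prop) (by fun_prop) fun q hq => ?_)).add
    (.mul (.div (by fun_prop) (by fun_prop) fun q hq => ?_) h22)).add
    (.mul (.div (by fun_prop) (by fun_prop) fun q hq => ?_) h12)).sub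
    (.div (by fun_prop) (by fun_prop) fun q hq => ?_)
  all_goals
    have := N.a_ne_zero hq
    have := N.one_sub_a_ne_zero hq
    positivity

theorem c₂_smooth : ContDiffOn ℝ ∞ N.c₂ U := by
  have ha := N.a_smooth
  have h1 := N.a₁_smooth
  have h2 := N.a₂_smooth
  have hK := N.K_smooth
  have hK1 := N.K₁_smooth
  have hK2 := N.K₂_smooth
  unfold c₂
  refine (ContDiffOn.div (by fun_prop) (by fun_prop) fun q hq => ?_).add
    (.mul (.div (by fun_prop) (by fun_prop) fun q hq => ?_) hK)
  all_goals
    have := N.a_ne_zero hq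
    have := N.one_sub_a_ne_zero hq
    positivity

section

variable {q : Plane} (hq : q ∈ U)
include hq

theorem cov_a : N.HasCovAt 0 N.a (N.a₁ q) (N.a₂ q) q :=
  N.hasCovAt_of_smooth W.isOpen N.a_smooth 0 hq

/-- The curvature term of the commutator carries the weight as a factor, and `a` has weight 0. -/
theorem δ₂_a₁ : N.δ₂ 1 N.a₁ q = N.a₁₂ q := by
  have h := N.δ_comm W.isOpen subset_rfl N.a_smooth 0 hq
  simp only [Nat.cast_zero, zero_mul, zero_add, sub_eq_zero] at h
  exact h

theorem δ₂_a₁_eventuallyEq : N.δ₂ 1 N.a₁ =ᶠ[𝓝 q] N.a₁₂ := by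
  filter_upwards [W.isOpen.mem_nhds hq] with z hz using N.δ₂_a₁ hz

theorem cov_a₁ : N.HasCovAt 1 N.a₁ (N.a₁₁ q) (N.a₁₂ q) q :=
  (N.hasCovAt_of_smooth W.isOpen N.a₁_smooth 1 hq).congr_cov rfl (N.δ₂_a₁ hq)

theorem cov_a₂ : N.HasCovAt 1 N.a₂ (N.a₁₂ q) (N.a₂₂ q) q :=
  N.hasCovAt_of_smooth W.isOpen N.a₂_smooth 1 hq

theorem cov_K : N.HasCovAt 2 N.K (N.K₁ q) (N.K₂ q) q :=
  N.hasCovAt_of_smooth W.isOpen N.K_smooth 2 hq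

theorem cov_c₀ : N.HasCovAt 2 N.c₀ (N.c₀₁ q) (N.c₀₂ q) q :=
  N.hasCovAt_of_smooth W.isOpen N.c₀_smooth 2 hq

theorem cov_c₁ : N.HasCovAt 3 N.c₁ (N.c₁₁ q) (N.c₁₂ q) q :=
  N.hasCovAt_of_smooth W.isOpen N.c₁_smooth 3 hq

theorem cov_c₂ : N.HasCovAt 3 N.c₂ (N.c₂₁ q) (N.c₂₂ q) q :=
  N.hasCovAt_of_smooth W.isOpen N.c₂_smooth 3 hq

theorem δ_of_δ₂_a₁ : N.δ₁ 2 (N.δ₂ 1 N.a₁) q = N.δ₁ 2 N.a₁₂ q ∧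
    N.δ₂ 2 (N.δ₂ 1 N.a₁) q = N.δ₂ 2 N.a₁₂ q := by
  have h := (N.hasCovAt_of_smooth W.isOpen N.a₁₂_smooth 2 hq).congr_of_eventuallyEq
    (N.δ₂_a₁_eventuallyEq hq)
  exact ⟨h.2.1, h.2.2⟩

theorem δ_a₂_comm : N.δ₂ 2 N.a₁₂ q - N.δ₁ 2 N.a₂₂ q = N.K q * N.a₂ q := by
  have h := N.δ_comm W.isOpen subset_rfl N.a₂_smooth 1 hq
  rw [Nat.cast_one, one_mul] at h
  exact h

theorem δ_a₁_comm : N.δ₂ 2 N.a₁₁ q - N.δ₁ 2 N.a₁₂ q = N.K q * N.a₁ q := by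
  have h := N.δ_comm W.isOpen subset_rfl N.a₁_smooth 1 hq
  rw [Nat.cast_one, one_mul] at h
  rw [← (N.δ_of_δ₂_a₁ hq).1]
  exact h

/-- Two of the three orderings agree and the third differs from them by the commutator `K a₁` on
weight 1, so averaging leaves a third of it. -/
theorem a₁₁₂_eq : N.a₁₁₂ q = N.δ₁ 2 N.a₁₂ q + N.K q * N.a₁ q / 3 := by
  have h : N.a₁₁₂ q = (N.δ₁ 2 N.a₁₂ q + N.δ₁ 2 (N.δ₂ 1 N.a₁) q + N.δ₂ 2 N.a₁₁ q) / 3 := rfl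
  rw [h, (N.δ_of_δ₂_a₁ hq).1]
  linarith [N.δ_a₁_comm hq]

/-- Here two of the three orderings differ from `δ₁ a₂₂` by `K a₂`, which gives the factor two
thirds. -/
theorem a₁₂₂_eq : N.a₁₂₂ q = N.δ₁ 2 N.a₂₂ q + 2 * (N.K q * N.a₂ q) / 3 := by
  have h : N.a₁₂₂ q = (N.δ₁ 2 N.a₂₂ q + N.δ₂ 2 N.a₁₂ q + N.δ₂ 2 (N.δ₂ 1 N.a₁) q) / 3 := rfl
  rw [h, (N.δ_of_δ₂_a₁ hq).2]
  linarith [N.δ_a₂_comm hq]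

theorem cov_a₁₂ : N.HasCovAt 2 N.a₁₂ (N.a₁₁₂ q - N.K q * N.a₁ q / 3)
    (N.a₁₂₂ q + N.K q * N.a₂ q / 3) q :=
  (N.hasCovAt_of_smooth W.isOpen N.a₁₂_smooth 2 hq).congr_cov (by linarith [N.a₁₁₂_eq hq])
    (by linarith [N.a₁₂₂_eq hq, N.δ_a₂_comm hq])

theorem cov_a₂₂ : N.HasCovAt 2 N.a₂₂ (N.a₁₂₂ q - 2 * (N.K q * N.a₂ q) / 3) (N.δ₂ 2 N.a₂₂ q) q :=
  (N.hasCovAt_of_smooth W.isOpen N.a₂₂_smooth 2 hq).congr_cov (by linarith [N.a₁₂₂_eq hq]) rfl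

end

/-- The common value of `δ₁ u`, `δ₂ u` and `-δ₁ v` for a solution of the abelian equation, in terms
of `w = δ₂ v`. -/
noncomputable def commonDerivative (v w : Plane → ℝ) (q : Plane) : ℝ := -(N.a q * w q + N.a₂ q * v q)

/-- The value of `δ₁ δ₂ v` for a solution of the abelian equation, in terms of `w = δ₂ v`. -/
noncomputable def jetδ₁ (u v w : Plane → ℝ) (q : Plane) : ℝ :=
  (N.a₁ q * w q + N.a q * N.a₂ q * w q + N.a₁₂ q * v q + N.a₂ q * N.a₂ q * v q
    - N.K q * (u q + v q)) / (1 - N.a q)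

/-- The value of `δ₂ δ₂ v` for a solution of the abelian equation, in terms of `w = δ₂ v`. -/
noncomputable def jetδ₂ (u v w : Plane → ℝ) (q : Plane) : ℝ :=
  (N.jetδ₁ u v w q + N.K q * v q - (N.a₂ q * w q + N.a₂ q * w q) - N.a₂₂ q * v q) / N.a q

/-- The functions `u`, `v`, `w` satisfy at `q` the prolongation of the abelian equation to the
system of total derivatives of `u`, `v` and `w = δ₂ v`. -/
def JetSolvesAt (u v w : Plane → ℝ) (q : Plane) : Prop :=
  N.HasCovAt 1 u (N.commonDerivative v w q) (N.commonDerivative v w q) q ∧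
  N.HasCovAt 1 v (-N.commonDerivative v w q) (w q) q ∧
  N.HasCovAt 2 w (N.jetδ₁ u v w q) (N.jetδ₂ u v w q) q

variable {N} in
-- Leibniz rule with the derivatives of `v` and `w` left free, so that it serves both to derive the
-- formulas for `δ₁ w`, `δ₂ w` and to verify them.
theorem cov_commonDerivative {v w : Plane → ℝ} {d₁ d₂ e₁ e₂ : ℝ} {q : Plane} (hq : q ∈ U)
    (hv : N.HasCovAt 1 v d₁ d₂ q) (hw : N.HasCovAt 2 w e₁ e₂ q) :
    N.HasCovAt 2 (N.commonDerivative v w)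
      (-(N.a₁ q * w q + N.a q * e₁ + (N.a₁₂ q * v q + N.a₂ q * d₁)))
      (-(N.a₂ q * w q + N.a q * e₂ + (N.a₂₂ q * v q + N.a₂ q * d₂))) q := by
  have h1 := (N.cov_a hq).mul hw
  have h2 := (N.cov_a₂ hq).mul hv
  rw [zero_add] at h1
  exact (h1.add h2).neg

/-- The formulas `jetδ₁` and `jetδ₂` come from solving the commutation relations of `u` and `v`, so
both relations hold identically; this is the one for `u`. -/
theorem jet_comm_u {u v w : Plane → ℝ} {q : Plane} (hq : q ∈ U) (h : N.JetSolvesAt u v w q) :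
    N.δ₂ 2 (N.commonDerivative v w) q - N.δ₁ 2 (N.commonDerivative v w) q = N.K q * u q := by
  obtain ⟨-, hv, hw⟩ := h
  have ha := N.a_ne_zero hq
  have ha1 := N.one_sub_a_ne_zero hq
  have hc := cov_commonDerivative hq hv hw
  rw [hc.2.1, hc.2.2]
  simp only [jetδ₂, jetδ₁, commonDerivative]
  field_simp
  ring

theorem jet_comm_v {u v w : Plane → ℝ} {q : Plane} (hq : q ∈ U) (h : N.JetSolvesAt u v w q) :
    N.δ₂ 2 (fun z => -N.commonDerivative v w z) q - N.δ₁ 2 w q = N.K q * v q := by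
  obtain ⟨-, hv, hw⟩ := h
  have ha := N.a_ne_zero hq
  have hc := (cov_commonDerivative hq hv hw).neg
  rw [hc.2.2, hw.2.1]
  simp only [jetδ₂]
  field_simp
  ring

/-- The commutator of the second derivatives of `w` is the obstruction `c₀ w + c₁ v + c₂ u`. -/
theorem jet_comm_w {u v w : Plane → ℝ} {q : Plane} (hq : q ∈ U) (h : N.JetSolvesAt u v w q) :
    N.δ₂ 3 (N.jetδ₁ u v w) q - N.δ₁ 3 (N.jetδ₂ u v w) q
      = 2 * N.K q * w q - 4 * (N.c₀ q * w q + N.c₁ q * v q + N.c₂ q * u q) := by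
  obtain ⟨hu, hv, hw⟩ := h
  have ha := N.a_ne_zero hq
  have ha1 := N.one_sub_a_ne_zero hq
  have ca := N.cov_a hq
  have ca2 := N.cov_a₂ hq
  have cK := N.cov_K hq
  -- The calculus rules compute the covariant derivatives left as placeholders. Among the third
  -- derivatives of `a` only those of `a₁₂` and `δ₁ a₂₂`, besides `δ₁ a₁₂`, survive into the
  -- commutator, so the unsymmetrized `δ₂ a₂₂` never enters.
  have h1 : N.HasCovAt 3 (N.jetδ₁ u v w) _ _ q :=
    HasCovAt.div (k := 3) (l := 0) ((((((N.cov_a₁ hq).mul hw).add ((ca.mul ca2).mul hw)).add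
      ((N.cov_a₁₂ hq).mul hv)).add ((ca2.mul ca2).mul hv)).sub (cK.mul (hu.add hv)))
      ((HasCovAt.const 1).sub ca) ha1
  have h2 : N.HasCovAt 3 (N.jetδ₂ u v w) _ _ q :=
    HasCovAt.div (k := 3) (l := 0) (((h1.add (cK.mul hv)).sub
      ((ca2.mul hw).add (ca2.mul hw))).sub ((N.cov_a₂₂ hq).mul hv)) ca ha
  rw [h1.2.2, h2.2.1]
  simp only [jetδ₂, jetδ₁, commonDerivative, c₀, c₁, c₂]
  generalize N.a q = a at *
  generalize N.a₁ q = a₁ at *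
  generalize N.a₂ q = a₂ at *
  field_simp
  ring

end FourWeb.Normalization

/-! ### The abelian equation in terms of `u` and `v`, and its first-order form where `c₀ ≠ 0`. -/

namespace FourWeb.Normalization

variable {U : Set Plane} {W : FourWeb U} (N : W.Normalization)

theorem multipliers_smooth {u v : Plane → ℝ} {V : Set Plane} (hVU : V ⊆ U)
    (hu : ContDiffOn ℝ ∞ u V) (hv : ContDiffOn ℝ ∞ v V) :
    ContDiffOn ℝ ∞ (N.multipliers u v) V := by
  have ha := N.a_smooth.mono hVU
  rw [contDiffOn_pi]
  intro i
  fin_cases i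
  · exact hu.add (ha.mul hv)
  · exact hu.add hv
  · exact hu
  · exact hv

theorem sum_multipliers_smul {u v : Plane → ℝ} {q : Plane} (hq : q ∈ U) :
    ∑ i, N.multipliers u v q i • N.η i q = 0 := by
  rw [Fin.sum_univ_four, N.η_two_eq hq, N.η_three_eq hq]
  apply clm_plane_ext <;>
  · simp [multipliers]
    ring

/-- The multipliers of a relation `∑ lᵢ ωᵢ = 0` are parametrized by the last two of them. -/
theorem eq_multipliers {l : Fin 4 → ℝ} {q : Plane} (hq : q ∈ U)
    (h : ∑ i, l i • N.η i q = 0) : l 0 = l 2 + N.a q * l 3 ∧ l 1 = l 2 + l 3 := by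
  rw [Fin.sum_univ_four, N.η_two_eq hq, N.η_three_eq hq] at h
  have h1 := DFunLike.congr_fun h (N.frame₁ q)
  have h2 := DFunLike.congr_fun h (N.frame₂ q)
  simp [N.η_zero_frame₁ hq, N.η_one_frame₁, N.η_zero_frame₂, N.η_one_frame₂ hq] at h1 h2
  constructor <;> linarith

/-- Writing each form in the coframe `ω₁, ω₂` gives four linear equations in the first derivatives.
Their sum is trivial, so three remain, and they leave only `δ₂ v` undetermined. -/
theorem extD_multipliers {u v : Plane → ℝ} {q : Plane} (hq : q ∈ U)
    (hu : DifferentiableAt ℝ u q) (hv : DifferentiableAt ℝ v q) :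
    (∀ i, extD (fun z => N.multipliers u v z i • N.η i z) q = 0) ↔
      N.δ₁ 1 u q = N.commonDerivative v (N.δ₂ 1 v) q ∧
      N.δ₂ 1 u q = N.commonDerivative v (N.δ₂ 1 v) q ∧
      N.δ₁ 1 v q = -N.commonDerivative v (N.δ₂ 1 v) q := by
  have ca := N.cov_a hq
  have cu : N.HasCovAt 1 u _ _ q := .intro hu
  have cv : N.HasCovAt 1 v _ _ q := .intro hv
  have cav : N.HasCovAt 1 (fun z => N.a z * v z) _ _ q := ca.mul cv
  have c0 : N.HasCovAt 1 (fun _ => (0 : ℝ)) 0 0 q := by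
    refine ⟨by fun_prop, ?_, ?_⟩ <;> simp [δ₁, δ₂]
  have hvol := N.vol_ne_zero hq
  have key : ∀ (θ : OneForm) (f₁ f₂ : Plane → ℝ) (d₁ d₂ e₁ e₂ : ℝ), N.HasCovAt 1 f₁ d₁ d₂ q →
      N.HasCovAt 1 f₂ e₁ e₂ q → (∀ z ∈ U, θ z = f₁ z • N.η 0 z + f₂ z • N.η 1 z) →
      (extD θ q = 0 ↔ e₁ - d₂ = 0) := by
    rintro θ f₁ f₂ d₁ d₂ e₁ e₂ ⟨h1, rfl, rfl⟩ ⟨h2, rfl, rfl⟩ hθ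
    have e : θ =ᶠ[𝓝 q] fun z => f₁ z • N.η 0 z + f₂ z • N.η 1 z := by
      filter_upwards [W.isOpen.mem_nhds hq] with z hz using hθ z hz
    rw [extD_congr e, N.extD_combination hq h1 h2, mul_eq_zero, or_iff_left hvol]
  have k0 := key (fun z => N.multipliers u v z 0 • N.η 0 z) _ _ _ _ _ _ (cu.add cav) c0
    (fun z _ => by simp [multipliers])
  have k1 := key (fun z => N.multipliers u v z 1 • N.η 1 z) _ _ _ _ _ _ c0 (cu.add cv)
    (fun z _ => by simp [multipliers])
  have k2 := key (fun z => N.multipliers u v z 2 • N.η 2 z) _ _ _ _ _ _ cu.neg cu.neg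
    (fun z hz => by
      rw [N.η_two_eq hz]
      apply clm_plane_ext <;>
      · simp [multipliers]
        ring)
  have k3 := key (fun z => N.multipliers u v z 3 • N.η 3 z) _ _ _ _ _ _ cav.neg cv.neg
    (fun z hz => by
      rw [N.η_three_eq hz]
      apply clm_plane_ext <;>
      · simp [multipliers]
        ring)
  rw [Fin.forall_fin_succ, Fin.forall_fin_succ, Fin.forall_fin_two]
  change _ ∧ _ ∧ _ ∧ _ ↔ _
  rw [show (Fin.succ 0 : Fin 4) = 1 from rfl]
  change _ ∧ _ ∧ extD (fun z => N.multipliers u v z 2 • N.η 2 z) q = 0 ∧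
    extD (fun z => N.multipliers u v z 3 • N.η 3 z) q = 0 ↔ _
  rw [k0, k1, k2, k3]
  simp only [commonDerivative]
  constructor
  · rintro ⟨h0, h1, h2, h3⟩
    refine ⟨?_, ?_, ?_⟩ <;> linarith
  · rintro ⟨h1, h2, h3⟩
    refine ⟨?_, ?_, ?_, ?_⟩ <;> linarith

theorem isAbelianOn_multipliers_iff {u v : Plane → ℝ} {V : Set Plane} (hV : IsOpen V)
    (hVU : V ⊆ U) (hu : ContDiffOn ℝ ∞ u V) (hv : ContDiffOn ℝ ∞ v V) :
    IsAbelianOn N.η (N.multipliers u v) V ↔ ∀ q ∈ V,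
      N.δ₁ 1 u q = N.commonDerivative v (N.δ₂ 1 v) q ∧
      N.δ₂ 1 u q = N.commonDerivative v (N.δ₂ 1 v) q ∧
      N.δ₁ 1 v q = -N.commonDerivative v (N.δ₂ 1 v) q := by
  have key := fun q (hq : q ∈ V) => N.extD_multipliers (hVU hq)
    (hu.differentiableAt_of_isOpen hV hq) (hv.differentiableAt_of_isOpen hV hq)
  constructor
  · rintro ⟨-, h⟩ q hq
    exact (key q hq).1 (h q hq).2
  · intro h
    exact ⟨N.multipliers_smooth hVU hu hv, fun q hq =>
      ⟨N.sum_multipliers_smul (hVU hq), (key q hq).2 (h q hq)⟩⟩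

section Prolongation

variable {N} {u v : Plane → ℝ} {V : Set Plane} (hV : IsOpen V) (hVU : V ⊆ U)
  (hu : ContDiffOn ℝ ∞ u V) (hv : ContDiffOn ℝ ∞ v V)
  (h : IsAbelianOn N.η (N.multipliers u v) V)
include hV hVU hu hv h

/-- Solutions of the abelian equation satisfy its prolongation. -/
theorem jetSolvesAt_of_isAbelianOn {q : Plane} (hq : q ∈ V) :
    N.JetSolvesAt u v (N.δ₂ 1 v) q := by
  rw [N.isAbelianOn_multipliers_iff hV hVU hu hv] at h
  have hw := N.δ₂_smooth hV hVU 1 hv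
  have cw := N.hasCovAt_of_smooth hV hw 2 hq
  have cv : N.HasCovAt 1 v _ _ q :=
    (N.hasCovAt_of_smooth hV hv 1 hq).congr_cov (h q hq).2.2 rfl
  have cf := cov_commonDerivative (hVU hq) cv cw
  have e1 := cf.congr_of_eventuallyEq
    (by filter_upwards [hV.mem_nhds hq] with z hz using (h z hz).1)
  have e2 := cf.congr_of_eventuallyEq
    (by filter_upwards [hV.mem_nhds hq] with z hz using (h z hz).2.1)
  have e3 := cf.neg.congr_of_eventuallyEq
    (by filter_upwards [hV.mem_nhds hq] with z hz using (h z hz).2.2)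
  have hcu := N.δ_comm hV hVU hu 1 hq
  have hcv := N.δ_comm hV hVU hv 1 hq
  rw [Nat.cast_one, one_mul] at hcu hcv
  rw [show 1 + 1 = 2 from rfl, e1.2.2, e2.2.1] at hcu
  rw [show 1 + 1 = 2 from rfl, e3.2.2] at hcv
  have ha := N.a_ne_zero (hVU hq)
  have ha1 := N.one_sub_a_ne_zero (hVU hq)
  simp only [commonDerivative] at hcu hcv
  -- Adding the commutation relations of `u` and `v` eliminates `δ₂ w` and leaves `(1 - a) δ₁ w`;
  -- the relation for `v` alone then gives `a δ₂ w`.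
  have hj1 : N.δ₁ 2 (N.δ₂ 1 v) q = N.jetδ₁ u v (N.δ₂ 1 v) q := by
    rw [jetδ₁, eq_div_iff ha1]
    linarith
  have hj2 : N.δ₂ 2 (N.δ₂ 1 v) q = N.jetδ₂ u v (N.δ₂ 1 v) q := by
    rw [jetδ₂, eq_div_iff ha, ← hj1]
    linarith
  exact ⟨(N.hasCovAt_of_smooth hV hu 1 hq).congr_cov (h q hq).1 (h q hq).2.1, cv,
    cw.congr_cov hj1 hj2⟩

/-- The obstruction to the integrability of the prolongation vanishes on solutions. -/
theorem obstruction_eq_zero {q : Plane} (hq : q ∈ V) :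
    N.c₀ q * N.δ₂ 1 v q + N.c₁ q * v q + N.c₂ q * u q = 0 := by
  have hj := fun q (hq : q ∈ V) => jetSolvesAt_of_isAbelianOn hV hVU hu hv h hq
  have hw := N.δ₂_smooth hV hVU 1 hv
  have hc := N.δ_comm hV hVU hw 2 hq
  have e1 : N.δ₁ 2 (N.δ₂ 1 v) =ᶠ[𝓝 q] N.jetδ₁ u v (N.δ₂ 1 v) := by
    filter_upwards [hV.mem_nhds hq] with z hz using (hj z hz).2.2.2.1
  have e2 : N.δ₂ 2 (N.δ₂ 1 v) =ᶠ[𝓝 q] N.jetδ₂ u v (N.δ₂ 1 v) := by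
    filter_upwards [hV.mem_nhds hq] with z hz using (hj z hz).2.2.2.2
  have h3 := N.jet_comm_w (hVU hq) (hj q hq)
  have f1 : N.δ₂ 3 (N.δ₁ 2 (N.δ₂ 1 v)) q = N.δ₂ 3 (N.jetδ₁ u v (N.δ₂ 1 v)) q := by
    simp only [δ₂, e1.fderiv_eq, e1.eq_of_nhds]
  have f2 : N.δ₁ 3 (N.δ₂ 2 (N.δ₂ 1 v)) q = N.δ₁ 3 (N.jetδ₂ u v (N.δ₂ 1 v)) q := by
    simp only [δ₁, e2.fderiv_eq, e2.eq_of_nhds]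
  rw [show 2 + 1 = 3 from rfl, f1, f2, h3] at hc
  push_cast at hc
  linarith

end Prolongation

/-- Dividing the obstruction by `c₀` gives `δ₂ v`, and the other three derivatives are expressed
through it. Conversely the four equations contain the three closedness equations algebraically,
without prolongation. -/
theorem isAbelianOn_iff_solvesAt {V : Set Plane} (hV : IsOpen V) (hVU : V ⊆ U)
    (h0 : ∀ q ∈ V, N.c₀ q ≠ 0) {u v : Plane → ℝ} (hu : ContDiffOn ℝ ∞ u V)
    (hv : ContDiffOn ℝ ∞ v V) :
    IsAbelianOn N.η (N.multipliers u v) V ↔ ∀ q ∈ V, N.SolvesAt u v q := by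
  constructor
  · intro h q hq
    have ho := obstruction_eq_zero hV hVU hu hv h hq
    obtain ⟨h1, h2, h3⟩ := (N.isAbelianOn_multipliers_iff hV hVU hu hv).1 h q hq
    have hc := h0 q hq
    have hw : N.δ₂ 1 v q = -((N.c₁ q * v q + N.c₂ q * u q) / N.c₀ q) := by
      rw [← neg_div, eq_div_iff hc]
      linarith
    have hf : N.commonDerivative v (N.δ₂ 1 v) q
        = N.a q * N.c₂ q / N.c₀ q * u q
          + (N.a q * N.c₁ q - N.a₂ q * N.c₀ q) / N.c₀ q * v q := by
      simp only [commonDerivative, hw]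
      field_simp
      ring
    refine ⟨?_, ?_, ?_, ?_⟩
    · rw [h1, hf]
      simp [M₁]
    · rw [h2, hf]
      simp [M₂]
    · rw [h3, hf]
      simp [M₁]
      field_simp
      ring
    · rw [hw]
      simp [M₂]
      field_simp
      ring
  · intro h
    rw [N.isAbelianOn_multipliers_iff hV hVU hu hv]
    intro q hq
    obtain ⟨h1, h2, h3, h4⟩ := h q hq
    have hc := h0 q hq
    simp only [commonDerivative]
    rw [h4, h1, h2, h3]
    simp [M₁, M₂]
    refine ⟨?_, ?_⟩
    · field_simp
      ring
    · field_simp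
      ring

section

variable {q : Plane} (hq : q ∈ U) (h0 : N.c₀ q ≠ 0)
include hq h0

theorem cov_M₁_zero_zero : N.HasCovAt 1 (fun z => N.M₁ z 0 0)
    (((N.a₁ q * N.c₂ q + N.a q * N.c₂₁ q) * N.c₀ q - N.a q * N.c₂ q * N.c₀₁ q) / N.c₀ q ^ 2)
    (((N.a₂ q * N.c₂ q + N.a q * N.c₂₂ q) * N.c₀ q - N.a q * N.c₂ q * N.c₀₂ q) / N.c₀ q ^ 2) q :=
  HasCovAt.div (k := 1) (l := 2) ((N.cov_a hq).mul (N.cov_c₂ hq)) (N.cov_c₀ hq) h0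

theorem cov_M₁_zero_one : N.HasCovAt 1 (fun z => N.M₁ z 0 1)
    (((N.a₁ q * N.c₁ q + N.a q * N.c₁₁ q - (N.a₁₂ q * N.c₀ q + N.a₂ q * N.c₀₁ q)) * N.c₀ q
      - (N.a q * N.c₁ q - N.a₂ q * N.c₀ q) * N.c₀₁ q) / N.c₀ q ^ 2)
    (((N.a₂ q * N.c₁ q + N.a q * N.c₁₂ q - (N.a₂₂ q * N.c₀ q + N.a₂ q * N.c₀₂ q)) * N.c₀ q
      - (N.a q * N.c₁ q - N.a₂ q * N.c₀ q) * N.c₀₂ q) / N.c₀ q ^ 2) q := by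
  have h := (N.cov_a hq).mul (N.cov_c₁ hq)
  rw [zero_add] at h
  exact HasCovAt.div (k := 1) (l := 2) (h.sub ((N.cov_a₂ hq).mul (N.cov_c₀ hq))) (N.cov_c₀ hq) h0

theorem cov_M₁_one_zero : N.HasCovAt 1 (fun z => N.M₁ z 1 0)
    (-N.δ₁ 1 (fun z => N.M₁ z 0 0) q) (-N.δ₂ 1 (fun z => N.M₁ z 0 0) q) q :=
  (HasCovAt.intro (N.cov_M₁_zero_zero hq h0).1).neg

theorem cov_M₁_one_one : N.HasCovAt 1 (fun z => N.M₁ z 1 1)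
    (-N.δ₁ 1 (fun z => N.M₁ z 0 1) q) (-N.δ₂ 1 (fun z => N.M₁ z 0 1) q) q := by
  have h : (fun z => N.M₁ z 1 1) = fun z => -N.M₁ z 0 1 := by
    funext z
    simp only [M₁, Matrix.of_apply, Matrix.cons_val', Matrix.cons_val_zero, Matrix.cons_val_one,
      Matrix.cons_val_fin_one]
    ring
  rw [h]
  exact (HasCovAt.intro (N.cov_M₁_zero_one hq h0).1).neg

theorem cov_M₂_one_zero : N.HasCovAt 1 (fun z => N.M₂ z 1 0)
    (-((N.c₂₁ q * N.c₀ q - N.c₂ q * N.c₀₁ q) / N.c₀ q ^ 2))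
    (-((N.c₂₂ q * N.c₀ q - N.c₂ q * N.c₀₂ q) / N.c₀ q ^ 2)) q :=
  (HasCovAt.div (k := 1) (l := 2) (N.cov_c₂ hq) (N.cov_c₀ hq) h0).neg

theorem cov_M₂_one_one : N.HasCovAt 1 (fun z => N.M₂ z 1 1)
    (-((N.c₁₁ q * N.c₀ q - N.c₁ q * N.c₀₁ q) / N.c₀ q ^ 2))
    (-((N.c₁₂ q * N.c₀ q - N.c₁ q * N.c₀₂ q) / N.c₀ q ^ 2)) q :=
  (HasCovAt.div (k := 1) (l := 2) (N.cov_c₁ hq) (N.cov_c₀ hq) h0).neg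

theorem differentiableAt_M₁ (i j : Fin 2) : DifferentiableAt ℝ (fun z => N.M₁ z i j) q := by
  fin_cases i <;> fin_cases j
  exacts [(N.cov_M₁_zero_zero hq h0).1, (N.cov_M₁_zero_one hq h0).1,
    (N.cov_M₁_one_zero hq h0).1, (N.cov_M₁_one_one hq h0).1]

theorem differentiableAt_M₂ (i j : Fin 2) : DifferentiableAt ℝ (fun z => N.M₂ z i j) q := by
  fin_cases i <;> fin_cases j
  exacts [(N.cov_M₁_zero_zero hq h0).1, (N.cov_M₁_zero_one hq h0).1,
    (N.cov_M₂_one_zero hq h0).1, (N.cov_M₂_one_one hq h0).1]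

theorem sq_smul_compat :
    N.c₀ q ^ 2 • N.compat q = !![N.G₁₁ q, N.G₁₂ q; N.G₂₁ q, N.G₂₂ q] := by
  -- The first rows of `M₁` and `M₂` coincide because `δ₁ u = δ₂ u`; the second row of `M₁` is minus
  -- its first because `δ₁ v = -δ₁ u`.
  have e0 : (fun z => N.M₂ z 0 0) = fun z => N.M₁ z 0 0 := rfl
  have e1 : (fun z => N.M₂ z 0 1) = fun z => N.M₁ z 0 1 := rfl
  have h00 := N.cov_M₁_zero_zero hq h0
  have h01 := N.cov_M₁_zero_one hq h0
  have h10 := N.cov_M₁_one_zero hq h0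
  have h11 := N.cov_M₁_one_one hq h0
  have k10 := N.cov_M₂_one_zero hq h0
  have k11 := N.cov_M₂_one_one hq h0
  rw [h00.2.1, h00.2.2] at h10
  rw [h01.2.1, h01.2.2] at h11
  ext i j
  fin_cases i <;> fin_cases j
  · simp [compat, e0, h00.2.1, h00.2.2, Matrix.mul_apply, Fin.sum_univ_two]
    simp [M₁, M₂, G₁₁]
    field_simp
    ring
  · simp [compat, e1, h01.2.1, h01.2.2, Matrix.mul_apply, Fin.sum_univ_two]
    simp [M₁, M₂, G₁₂]
    field_simp
    ring
  · simp [compat, h10.2.2, k10.2.1, Matrix.mul_apply, Fin.sum_univ_two]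
    simp [M₁, M₂, G₂₁]
    field_simp
    ring
  · simp [compat, h11.2.2, k11.2.1, Matrix.mul_apply, Fin.sum_univ_two]
    simp [M₁, M₂, G₂₂]
    field_simp
    ring

/-- The compatibility matrix expresses the commutator of the derivatives of the first-order
system. -/
theorem comm_eq_compat {u v : Plane → ℝ} (hu : DifferentiableAt ℝ u q)
    (hv : DifferentiableAt ℝ v q) (h : N.SolvesAt u v q) (i : Fin 2) :
    N.δ₂ 2 (fun z => N.M₁ z i 0 * u z + N.M₁ z i 1 * v z) q
      - N.δ₁ 2 (fun z => N.M₂ z i 0 * u z + N.M₂ z i 1 * v z) q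
      = N.compat q i 0 * u q + N.compat q i 1 * v q + N.K q * ![u q, v q] i := by
  obtain ⟨h1, h2, h3, h4⟩ := h
  have cu : N.HasCovAt 1 u _ _ q := .intro hu
  have cv : N.HasCovAt 1 v _ _ q := .intro hv
  rw [h1, h2] at cu
  rw [h3, h4] at cv
  have m1 := fun j => HasCovAt.intro (N := N) (k := 1) (N.differentiableAt_M₁ hq h0 i j)
  have m2 := fun j => HasCovAt.intro (N := N) (k := 1) (N.differentiableAt_M₂ hq h0 i j)
  have t1 : N.HasCovAt 2 (fun z => N.M₁ z i 0 * u z + N.M₁ z i 1 * v z) _ _ q :=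
    ((m1 0).mul cu).add ((m1 1).mul cv)
  have t2 : N.HasCovAt 2 (fun z => N.M₂ z i 0 * u z + N.M₂ z i 1 * v z) _ _ q :=
    ((m2 0).mul cu).add ((m2 1).mul cv)
  rw [t1.2.2, t2.2.1]
  fin_cases i <;>
  · simp [compat, Matrix.mul_apply, Fin.sum_univ_two]
    ring

end

end FourWeb.Normalization

/-! ### Covariant linear systems with arbitrary weights. -/

namespace FourWeb.Normalization

variable {U : Set Plane} {W : FourWeb U} (N : W.Normalization)

section CovariantSystems

variable {n : ℕ} (k : Fin n → ℕ) (P₁ P₂ : Plane → Matrix (Fin n) (Fin n) ℝ)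

/-- The vector-valued function `Z`, with components of weights `k j`, satisfies at `q` the linear
system `δ₁ Z = P₁ Z`, `δ₂ Z = P₂ Z`. -/
def SystemAt (Z : Plane → Fin n → ℝ) (q : Plane) : Prop :=
  DifferentiableAt ℝ Z q ∧ ∀ j, N.δ₁ (k j) (fun z => Z z j) q = ∑ m, P₁ q j m * Z q m ∧
    N.δ₂ (k j) (fun z => Z z j) q = ∑ m, P₂ q j m * Z q m

/-- The connection form of the system `δ₁ Z = P₁ Z`, `δ₂ Z = P₂ Z`, evaluated on the vector `x`. -/
noncomputable def connection (x q : Plane) : (Fin n → ℝ) →L[ℝ] (Fin n → ℝ) :=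
  ∑ j, ∑ m, (P₁ q j m * N.η 0 q x + P₂ q j m * N.η 1 q x
    + (if j = m then (k j : ℝ) else 0) * N.γ q x) •
    (ContinuousLinearMap.proj (R := ℝ) (φ := fun _ : Fin n => ℝ) m).smulRight
      (Pi.single j (1 : ℝ) : Fin n → ℝ)

theorem connection_apply (x q : Plane) (z : Fin n → ℝ) (j : Fin n) :
    N.connection k P₁ P₂ x q z j = (∑ m, P₁ q j m * z m) * N.η 0 q x
      + (∑ m, P₂ q j m * z m) * N.η 1 q x + k j * z j * N.γ q x := by
  have h : N.connection k P₁ P₂ x q z j = ∑ m, (P₁ q j m * N.η 0 q x + P₂ q j m * N.η 1 q x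
    + (if j = m then (k j : ℝ) else 0) * N.γ q x) * z m := by
    simp [connection, Finset.sum_apply, Pi.single_apply]
  rw [h]
  simp only [add_mul, Finset.sum_add_distrib, Finset.sum_mul, ite_mul, zero_mul,
    Finset.sum_ite_eq, Finset.mem_univ, if_true]
  congr 1
  · congr 1 <;> exact Finset.sum_congr rfl fun m _ => by ring
  · ring

theorem connection_smooth {V : Set Plane} (hVU : V ⊆ U)
    (h₁ : ∀ i j, ContDiffOn ℝ ∞ (fun q => P₁ q i j) V)
    (h₂ : ∀ i j, ContDiffOn ℝ ∞ (fun q => P₂ q i j) V) (x : Plane) :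
    ContDiffOn ℝ ∞ (N.connection k P₁ P₂ x) V := by
  have hη := fun i => ((N.η_smooth i).mono hVU).clm_apply (contDiffOn_const (c := x))
  have hγ := (N.γ_smooth.mono hVU).clm_apply (contDiffOn_const (c := x))
  unfold connection
  refine ContDiffOn.sum fun j _ => ContDiffOn.sum fun m _ => ?_
  have hc : ContDiffOn ℝ ∞ (fun q => P₁ q j m * N.η 0 q x + P₂ q j m * N.η 1 q x
      + (if j = m then (k j : ℝ) else 0) * N.γ q x) V :=
    (((h₁ j m).mul (hη 0)).add ((h₂ j m).mul (hη 1))).add (contDiffOn_const.mul hγ)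
  exact hc.smul contDiffOn_const

variable {q : Plane} (hq : q ∈ U)
include hq

theorem γ_frame₁ : N.γ q (N.frame₁ q) = N.g₁ q := by
  simp [γ, N.η_zero_frame₁ hq, N.η_one_frame₁]

theorem γ_frame₂ : N.γ q (N.frame₂ q) = N.g₂ q := by
  simp [γ, N.η_zero_frame₂, N.η_one_frame₂ hq]

/-- Translation into a coordinate system `∂ₓ Z = A Z`, `∂ᵧ Z = B Z`: the weights are absorbed as a
diagonal `γ` term of the connection matrices. -/
theorem systemAt_iff_hasFDerivAt {Z : Plane → Fin n → ℝ} :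
    N.SystemAt k P₁ P₂ Z q ↔
      HasFDerivAt Z ((ContinuousLinearMap.fst ℝ ℝ ℝ).smulRight
          (N.connection k P₁ P₂ (1, 0) q (Z q))
        + (ContinuousLinearMap.snd ℝ ℝ ℝ).smulRight (N.connection k P₁ P₂ (0, 1) q (Z q))) q := by
  constructor
  · rintro ⟨hd, h⟩
    rw [hasFDerivAt_pi']
    intro j
    have hj := (differentiableAt_pi.1 hd j).hasFDerivAt
    rw [N.fderiv_eq_frame hq _ (k j), (h j).1, (h j).2] at hj
    refine hj.congr_fderiv ?_
    apply clm_plane_ext <;> simp [connection_apply]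
  · intro hd
    refine ⟨hd.differentiableAt, fun j => ?_⟩
    have hj := (hasFDerivAt_pi'.1 hd j).fderiv
    have key : ∀ x, fderiv ℝ (fun z => Z z j) q x = N.connection k P₁ P₂ x q (Z q) j := by
      intro x
      rw [hj, clm_plane_apply]
      have e0 := clm_plane_apply (N.η 0 q) x
      have e1 := clm_plane_apply (N.η 1 q) x
      have e2 := clm_plane_apply (N.γ q) x
      rw [connection_apply, e0, e1, e2]
      simp [connection_apply]
      ring
    simp only [δ₁, δ₂, key, connection_apply, N.η_zero_frame₁ hq, N.η_one_frame₁,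
      N.η_zero_frame₂, N.η_one_frame₂ hq, N.γ_frame₁ hq, N.γ_frame₂ hq]
    constructor <;> ring

omit hq

/-- A solution of a covariant linear system on a convex set that vanishes at a point vanishes. -/
theorem eq_zero_of_systemAt {V : Set Plane} (hVc : Convex ℝ V) (hVU : V ⊆ U)
    (h₁ : ∀ i j, ContDiffOn ℝ ∞ (fun q => P₁ q i j) V)
    (h₂ : ∀ i j, ContDiffOn ℝ ∞ (fun q => P₂ q i j) V) {Z : Plane → Fin n → ℝ}
    (hZ : ∀ q ∈ V, N.SystemAt k P₁ P₂ Z q) {p : Plane} (hp : p ∈ V) (hZp : Z p = 0) :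
    ∀ q ∈ V, Z q = 0 :=
  eq_zero_of_hasFDerivAt_of_convex hVc (N.connection_smooth k P₁ P₂ hVU h₁ h₂ _).continuousOn
    (N.connection_smooth k P₁ P₂ hVU h₁ h₂ _).continuousOn
    (fun q hq => (N.systemAt_iff_hasFDerivAt k P₁ P₂ (hVU hq)).1 (hZ q hq)) hp hZp

/-- Existence of solutions of a covariant linear system whose commutators agree with the
curvature. -/
theorem exists_systemAt {V : Set Plane} (hV : IsOpen V) (hVU : V ⊆ U)
    (h₁ : ∀ i j, ContDiffOn ℝ ∞ (fun q => P₁ q i j) V)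
    (h₂ : ∀ i j, ContDiffOn ℝ ∞ (fun q => P₂ q i j) V)
    (flat : ∀ q ∈ V, ∀ Z, N.SystemAt k P₁ P₂ Z q → ∀ j,
      N.δ₂ (k j + 1) (fun z => ∑ m, P₁ z j m * Z z m) q
        - N.δ₁ (k j + 1) (fun z => ∑ m, P₂ z j m * Z z m) q = k j * N.K q * Z q j)
    {p : Plane} (hp : p ∈ V) (z : Fin n → ℝ) :
    ∃ (Z : Plane → Fin n → ℝ) (O : Set Plane), IsOpen O ∧ p ∈ O ∧ O ⊆ V ∧ Z p = z ∧
      ContDiffOn ℝ ∞ Z O ∧ ∀ q ∈ O, N.SystemAt k P₁ P₂ Z q := by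
  have hA := N.connection_smooth k P₁ P₂ hVU h₁ h₂ (1, 0)
  have hB := N.connection_smooth k P₁ P₂ hVU h₁ h₂ (0, 1)
  obtain ⟨Z, O, hO, hpO, hOV, hZp, hZ⟩ := exists_hasFDerivAt_of_flat hV hp hA hB (by
    intro q hq
    ext1 ζ
    have hAd := hA.differentiableAt_of_isOpen hV hq
    have hBd := hB.differentiableAt_of_isOpen hV hq
    set A := N.connection k P₁ P₂ (1, 0) with hA_def
    set B := N.connection k P₁ P₂ (0, 1) with hB_def
    let T : Plane →L[ℝ] (Fin n → ℝ) := (ContinuousLinearMap.fst ℝ ℝ ℝ).smulRight (A q ζ)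
        + (ContinuousLinearMap.snd ℝ ℝ ℝ).smulRight (B q ζ)
    -- Flatness is a pointwise condition on the coefficients, so it can be tested on an affine
    -- function with value `ζ` at `q` that satisfies the system at `q` alone.
    let Y : Plane → Fin n → ℝ := fun x => ζ + T (x - q)
    have hYq : Y q = ζ := by simp [Y]
    have hY : HasFDerivAt Y T q := by
      have h0 : HasFDerivAt (fun x : Plane => x - q) (ContinuousLinearMap.id ℝ Plane) q :=
        (hasFDerivAt_id q).sub_const q
      exact (HasFDerivAt.comp (f := fun x : Plane => x - q) (g := T) q T.hasFDerivAt h0).const_add ζ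
    have hsys : N.SystemAt k P₁ P₂ Y q := by
      rw [N.systemAt_iff_hasFDerivAt k P₁ P₂ (hVU hq), hYq]
      exact hY
    have hYj := fun j => differentiableAt_pi.1 hY.differentiableAt j
    have hP : ∀ P : Plane → Matrix (Fin n) (Fin n) ℝ,
        (∀ i j, ContDiffOn ℝ ∞ (fun q => P q i j) V) → ∀ j,
        DifferentiableAt ℝ (fun x => ∑ m, P x j m * Y x m) q := fun P h j =>
      DifferentiableAt.fun_sum fun m _ =>
        ((h j m).differentiableAt_of_isOpen hV hq).mul (hYj m)
    have hAY : HasFDerivAt (fun x => A x (Y x)) _ q := hAd.hasFDerivAt.clm_apply hY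
    have hBY : HasFDerivAt (fun x => B x (Y x)) _ q := hBd.hasFDerivAt.clm_apply hY
    -- By the product rule this is flatness of `A` and `B` applied to `ζ`. Componentwise it says
    -- that the form `Θ` which the system prescribes for `dYⱼ` is closed at `q`, and this is the
    -- commutation hypothesis `flat`.
    have key : fderiv ℝ (fun x => B x (Y x)) q (1, 0)
        = fderiv ℝ (fun x => A x (Y x)) q (0, 1) := by
      funext j
      let Θ : OneForm := fun x => (∑ m, P₁ x j m * Y x m) • N.η 0 x
        + (∑ m, P₂ x j m * Y x m) • N.η 1 x + (k j * Y x j) • N.γ x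
      have hΘ : extD Θ q = 0 := by
        have h := N.extD_covariant (hVU hq) (k j) (f := fun x => Y x j) (hYj j) (hP P₁ h₁ j)
          (hP P₂ h₂ j) (hsys.2 j).1 (hsys.2 j).2
        rw [show extD Θ q = _ from h, mul_eq_zero]
        left
        linarith [flat q hq Y hsys j]
      have hη := fun i => (N.η_smooth i).differentiableAt_of_isOpen W.isOpen (hVU hq)
      have hγ := N.γ_smooth.differentiableAt_of_isOpen W.isOpen (hVU hq)
      have hΘd : DifferentiableAt ℝ Θ q :=
        (((hP P₁ h₁ j).fun_smul (hη 0)).fun_add ((hP P₂ h₂ j).fun_smul (hη 1))).fun_add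
          (((hYj j).const_mul _).fun_smul hγ)
      have hΘx : ∀ x y : Plane, fderiv ℝ Θ q y x
          = fderiv ℝ (fun z => N.connection k P₁ P₂ x z (Y z)) q y j := by
        intro x y
        have e1 : HasFDerivAt (fun z => Θ z x) _ q :=
          hΘd.hasFDerivAt.clm_apply (hasFDerivAt_const x q)
        have e2 : HasFDerivAt (fun z => N.connection k P₁ P₂ x z (Y z)) _ q :=
          ((N.connection_smooth k P₁ P₂ hVU h₁ h₂ x).differentiableAt_of_isOpen hV
            hq).hasFDerivAt.clm_apply hY
        have e3 : (fun z => Θ z x) = fun z => N.connection k P₁ P₂ x z (Y z) j := by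
          funext z
          simp [Θ, connection_apply]
        have e4 := (hasFDerivAt_pi'.1 e2.differentiableAt.hasFDerivAt j).unique (e3 ▸ e1)
        have e5 := DFunLike.congr_fun e4 y
        simpa using e5.symm
      have h := hΘ
      unfold extD at h
      rw [hΘx, hΘx, sub_eq_zero] at h
      exact h
    rw [hAY.fderiv, hBY.fderiv] at key
    simp [T, hYq] at key
    simp only [add_apply, ContinuousLinearMap.comp_apply]
    rw [add_comm, add_comm _ (B q (A q ζ))]
    exact key.symm) z
  exact ⟨Z, O, hO, hpO, hOV, hZp, contDiffOn_of_hasFDerivAt hO (hA.mono hOV) (hB.mono hOV) hZ,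
    fun q hq => (N.systemAt_iff_hasFDerivAt k P₁ P₂ (hVU (hOV hq))).2 (hZ q hq)⟩

end CovariantSystems

end FourWeb.Normalization

/-! ### Germs of solutions, their parameters `u`, `v`, and linear combinations. -/

theorem IsAbelianOn.congr {θ θ' : Fin 4 → OneForm} {l l' : Plane → Fin 4 → ℝ} {V : Set Plane}
    (hV : IsOpen V) (h : IsAbelianOn θ l V) (hl' : ContDiffOn ℝ ∞ l' V)
    (heq : ∀ q ∈ V, ∀ i, l' q i • θ' i q = l q i • θ i q) : IsAbelianOn θ' l' V := by
  refine ⟨hl', fun q hq => ⟨?_, fun i => ?_⟩⟩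
  · rw [← (h.2 q hq).1]
    exact Finset.sum_congr rfl fun i _ => heq q hq i
  · rw [← (h.2 q hq).2 i]
    apply extD_congr
    filter_upwards [hV.mem_nhds hq] with z hz using heq z hz i

namespace FourWeb.Normalization

variable {U : Set Plane} {W : FourWeb U} (N : W.Normalization)

/-- The multipliers of the original forms of the web for a solution of the abelian equation with
parameters `u` and `v`. -/
noncomputable def formMultipliers (u v : Plane → ℝ) (q : Plane) (i : Fin 4) : ℝ :=
  N.scale i q * N.multipliers u v q i

theorem isAbelianOn_formMultipliers {u v : Plane → ℝ} {V : Set Plane} (hV : IsOpen V)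
    (hVU : V ⊆ U) (h : IsAbelianOn N.η (N.multipliers u v) V) :
    IsAbelianOn W.form (N.formMultipliers u v) V := by
  refine h.congr hV ?_ fun q hq i => ?_
  · rw [contDiffOn_pi]
    exact fun i => ((N.scale_smooth i).mono hVU).mul (contDiffOn_pi.1 h.1 i)
  · rw [N.η_eq i q (hVU hq), formMultipliers, smul_smul, mul_comm]

theorem formMultipliers_mem_abelianGerms {u v : Plane → ℝ} {V : Set Plane} (hV : IsOpen V)
    (hVU : V ⊆ U) (h : IsAbelianOn N.η (N.multipliers u v) V) {p : Plane} (hpV : p ∈ V)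
    (hp : p ∈ U) :
    ((N.formMultipliers u v : Plane → Fin 4 → ℝ) : Germ (𝓝 p) (Fin 4 → ℝ))
      ∈ W.abelianGerms p hp :=
  ⟨_, V, hV, hpV, hVU, N.isAbelianOn_formMultipliers hV hVU h, rfl⟩

/-- Dividing by the nonvanishing scales turns multipliers of the original forms into multipliers of
the normalized ones; the relation then expresses the first two through the last two, which are `u`
and `v`. -/
theorem exists_formMultipliers_of_mem_abelianGerms {p : Plane} {hp : p ∈ U}
    {φ : Germ (𝓝 p) (Fin 4 → ℝ)} (hφ : φ ∈ W.abelianGerms p hp) :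
    ∃ (u v : Plane → ℝ) (V : Set Plane), IsOpen V ∧ p ∈ V ∧ V ⊆ U ∧ ContDiffOn ℝ ∞ u V ∧
      ContDiffOn ℝ ∞ v V ∧ IsAbelianOn N.η (N.multipliers u v) V ∧
      φ = ((N.formMultipliers u v : Plane → Fin 4 → ℝ) : Germ (𝓝 p) (Fin 4 → ℝ)) := by
  obtain ⟨l, V, hV, hpV, hVU, hl, rfl⟩ := hφ
  have hs := fun q (hq : q ∈ V) i => N.scale_ne_zero i q (hVU hq)
  have hsm : ∀ i, ContDiffOn ℝ ∞ (fun q => l q i / N.scale i q) V := fun i =>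
    (contDiffOn_pi.1 hl.1 i).div ((N.scale_smooth i).mono hVU) fun q hq => hs q hq i
  let u : Plane → ℝ := fun q => l q 2 / N.scale 2 q
  let v : Plane → ℝ := fun q => l q 3 / N.scale 3 q
  have hη : ∀ q ∈ V, ∀ i, (l q i / N.scale i q) • N.η i q = l q i • W.form i q := by
    intro q hq i
    rw [N.η_eq i q (hVU hq), smul_smul, div_mul_cancel₀ _ (hs q hq i)]
  have hm : ∀ q ∈ V, ∀ i, N.multipliers u v q i = l q i / N.scale i q := by
    intro q hq i
    have h0 : ∑ i, (l q i / N.scale i q) • N.η i q = 0 := by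
      rw [← (hl.2 q hq).1]
      exact Finset.sum_congr rfl fun i _ => hη q hq i
    obtain ⟨e0, e1⟩ := N.eq_multipliers (hVU hq) (l := fun i => l q i / N.scale i q) h0
    fin_cases i
    exacts [e0.symm, e1.symm, rfl, rfl]
  refine ⟨u, v, V, hV, hpV, hVU, hsm 2, hsm 3,
    hl.congr hV (N.multipliers_smooth hVU (hsm 2) (hsm 3)) fun q hq i => by
      rw [hm q hq i, hη q hq i], ?_⟩
  rw [Germ.coe_eq]
  filter_upwards [hV.mem_nhds hpV] with q hq
  funext i
  rw [formMultipliers, hm q hq i, mul_div_cancel₀ _ (hs q hq i)]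

section Combinations

variable {N} {n : ℕ} {k : ℕ} {q : Plane}

theorem HasCovAt.sum_mul {u : Fin n → Plane → ℝ} {d₁ d₂ : Fin n → ℝ} (g : Fin n → ℝ)
    (h : ∀ i, N.HasCovAt k (u i) (d₁ i) (d₂ i) q) :
    N.HasCovAt k (fun z => ∑ i, g i * u i z) (∑ i, g i * d₁ i) (∑ i, g i * d₂ i) q := by
  have hd : ∀ i ∈ Finset.univ, DifferentiableAt ℝ (fun z => g i * u i z) q := fun i _ =>
    (h i).1.const_mul _
  refine ⟨DifferentiableAt.fun_sum hd, ?_, ?_⟩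
  · simp only [δ₁, fderiv_fun_sum hd, sum_apply, Finset.mul_sum, ← Finset.sum_sub_distrib]
    refine Finset.sum_congr rfl fun i _ => ?_
    rw [fderiv_const_mul (h i).1, ← (h i).2.1, δ₁, smul_apply, smul_eq_mul]
    ring
  · simp only [δ₂, fderiv_fun_sum hd, sum_apply, Finset.mul_sum, ← Finset.sum_sub_distrib]
    refine Finset.sum_congr rfl fun i _ => ?_
    rw [fderiv_const_mul (h i).1, ← (h i).2.2, δ₂, smul_apply, smul_eq_mul]
    ring

theorem isAbelianOn_sum {u v : Fin n → Plane → ℝ} {V : Set Plane} (hV : IsOpen V) (hVU : V ⊆ U)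
    (hu : ∀ i, ContDiffOn ℝ ∞ (u i) V) (hv : ∀ i, ContDiffOn ℝ ∞ (v i) V)
    (h : ∀ i, IsAbelianOn N.η (N.multipliers (u i) (v i)) V) (g : Fin n → ℝ) :
    IsAbelianOn N.η (N.multipliers (fun z => ∑ i, g i * u i z) (fun z => ∑ i, g i * v i z)) V := by
  have h' := fun i => (N.isAbelianOn_multipliers_iff hV hVU (hu i) (hv i)).1 (h i)
  rw [N.isAbelianOn_multipliers_iff hV hVU
    (ContDiffOn.sum fun i _ => contDiffOn_const.mul (hu i))
    (ContDiffOn.sum fun i _ => contDiffOn_const.mul (hv i))]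
  intro q hq
  have cu := HasCovAt.sum_mul g fun i => N.hasCovAt_of_smooth hV (hu i) 1 hq
  have cv := HasCovAt.sum_mul g fun i => N.hasCovAt_of_smooth hV (hv i) 1 hq
  rw [cu.2.1, cu.2.2, cv.2.1]
  simp only [commonDerivative]
  rw [cv.2.2]
  simp only [fun i => (h' i q hq).1, fun i => (h' i q hq).2.1, fun i => (h' i q hq).2.2]
  simp only [commonDerivative, Finset.mul_sum, ← Finset.sum_add_distrib, ← Finset.sum_neg_distrib]
  refine ⟨?_, ?_, ?_⟩ <;> exact Finset.sum_congr rfl fun i _ => by ring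

theorem sum_smul_formMultipliers (u v : Fin n → Plane → ℝ) (g : Fin n → ℝ) :
    ∑ i, g i • N.formMultipliers (u i) (v i)
      = N.formMultipliers (fun z => ∑ i, g i * u i z) (fun z => ∑ i, g i * v i z) := by
  funext z j
  simp only [Finset.sum_apply, Pi.smul_apply, smul_eq_mul, formMultipliers]
  fin_cases j <;>
  · simp only [multipliers, Finset.mul_sum, ← Finset.sum_add_distrib]
    simp only [Finset.mul_sum, Fin.zero_eta, Fin.mk_one, Fin.reduceFinMk,
      Matrix.cons_val]
    refine Finset.sum_congr rfl fun i _ => ?_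
    ring

theorem sum_smul_germ {p : Plane} (f : Fin n → Plane → Fin 4 → ℝ) (g : Fin n → ℝ) :
    ∑ i, g i • ((f i : Plane → Fin 4 → ℝ) : Germ (𝓝 p) (Fin 4 → ℝ))
      = ((∑ i, g i • f i : Plane → Fin 4 → ℝ) : Germ (𝓝 p) (Fin 4 → ℝ)) := by
  induction n with
  | zero => simp
  | succ n ih =>
    rw [Fin.sum_univ_succ, Fin.sum_univ_succ, ih]
    rfl

/-- A combination of germs of solutions vanishes if and only if the combinations of their
parameters do. -/
theorem sum_smul_germ_formMultipliers_eq_zero_iff {p : Plane} (hp : p ∈ U)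
    (u v : Fin n → Plane → ℝ) (g : Fin n → ℝ) :
    ∑ i, g i • ((N.formMultipliers (u i) (v i) : Plane → Fin 4 → ℝ) : Germ (𝓝 p) (Fin 4 → ℝ)) = 0
      ↔ (∀ᶠ z in 𝓝 p, ∑ i, g i * u i z = 0) ∧ ∀ᶠ z in 𝓝 p, ∑ i, g i * v i z = 0 := by
  rw [sum_smul_germ, sum_smul_formMultipliers, ← Germ.coe_zero, Germ.coe_eq]
  constructor
  · intro h
    constructor
    · filter_upwards [h, W.isOpen.mem_nhds hp] with z hz hzU
      have := congrFun hz 2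
      exact (mul_eq_zero.1 this).resolve_left (N.scale_ne_zero 2 z hzU)
    · filter_upwards [h, W.isOpen.mem_nhds hp] with z hz hzU
      have := congrFun hz 3
      exact (mul_eq_zero.1 this).resolve_left (N.scale_ne_zero 3 z hzU)
  · rintro ⟨h1, h2⟩
    filter_upwards [h1, h2] with z e1 e2
    funext j
    simp only [formMultipliers, multipliers, e1, e2, Pi.zero_apply]
    fin_cases j <;> simp

end Combinations

/-- Solutions of the abelian equation whose parameters are independent as germs bound the rank from
below. -/
theorem le_rankAt {n : ℕ} {p : Plane} (hp : p ∈ U) (u v : Fin n → Plane → ℝ)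
    (V : Fin n → Set Plane) (hV : ∀ i, IsOpen (V i)) (hVU : ∀ i, V i ⊆ U) (hpV : ∀ i, p ∈ V i)
    (h : ∀ i, IsAbelianOn N.η (N.multipliers (u i) (v i)) (V i))
    (hli : ∀ g : Fin n → ℝ, (∀ᶠ z in 𝓝 p, ∑ i, g i * u i z = 0) →
      (∀ᶠ z in 𝓝 p, ∑ i, g i * v i z = 0) → g = 0) : (n : Cardinal) ≤ W.rankAt p hp := by
  let φ : Fin n → W.abelianGerms p hp := fun i =>
    ⟨_, N.formMultipliers_mem_abelianGerms (hV i) (hVU i) (h i) (hpV i) hp⟩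
  have hφ : LinearIndependent ℝ φ := by
    rw [Fintype.linearIndependent_iff]
    intro g hg
    have h0 := congrArg Subtype.val hg
    simp only [AddSubmonoidClass.coe_finsetSum, Submodule.coe_smul, Submodule.coe_zero, φ] at h0
    rw [sum_smul_germ_formMultipliers_eq_zero_iff hp] at h0
    exact congrFun (hli g h0.1 h0.2)
  have := hφ.cardinal_lift_le_rank
  simpa [rankAt] using this

end FourWeb.Normalization

/-- If the determinant vanished, `(y 1, -y 0)` and `(x 1, -x 0)` would both be relations, so all
entries would be zero, contradicting independence. -/
theorem cross_ne_zero_of_independent {x y : Fin 2 → ℝ}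
    (h : ∀ s t : ℝ, s * x 0 + t * x 1 = 0 → s * y 0 + t * y 1 = 0 → s = 0 ∧ t = 0) :
    x 0 * y 1 - x 1 * y 0 ≠ 0 := by
  intro h0
  obtain ⟨h1, h2⟩ := h (y 1) (-y 0) (by linarith) (by ring)
  obtain ⟨h3, h4⟩ := h (x 1) (-x 0) (by ring) (by linarith)
  have h5 := h 1 0 (by linarith) (by linarith)
  exact one_ne_zero h5.1

theorem eq_zero_of_cross_ne_zero {x y : Fin 2 → ℝ} (h : x 0 * y 1 - x 1 * y 0 ≠ 0) {r s : ℝ}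
    (hi : ∀ i, r * x i + s * y i = 0) : r = 0 ∧ s = 0 := by
  have h0 := hi 0
  have h1 := hi 1
  constructor
  · refine (mul_eq_zero.1 ?_).resolve_right h
    linear_combination y 1 * h0 - y 0 * h1
  · refine (mul_eq_zero.1 ?_).resolve_right h
    linear_combination x 0 * h1 - x 1 * h0

/-! ### The prolongation as a matrix system, and consequences of two independent solutions. -/

namespace FourWeb.Normalization

variable {U : Set Plane} {W : FourWeb U} (N : W.Normalization)

/-- The matrix of the equations `δ₁ (u, v, w) = …` of the prolongation. -/
noncomputable def jetMatrix₁ (q : Plane) : Matrix (Fin 3) (Fin 3) ℝ :=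
  !![0, -N.a₂ q, -N.a q;
     0, N.a₂ q, N.a q;
     -N.K q / (1 - N.a q), (N.a₁₂ q + N.a₂ q ^ 2 - N.K q) / (1 - N.a q),
       (N.a₁ q + N.a q * N.a₂ q) / (1 - N.a q)]

/-- The matrix of the equations `δ₂ (u, v, w) = …` of the prolongation. -/
noncomputable def jetMatrix₂ (q : Plane) : Matrix (Fin 3) (Fin 3) ℝ :=
  !![0, -N.a₂ q, -N.a q;
     0, 0, 1;
     -N.K q / (1 - N.a q) / N.a q,
       ((N.a₁₂ q + N.a₂ q ^ 2 - N.K q) / (1 - N.a q) + N.K q - N.a₂₂ q) / N.a q,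
       ((N.a₁ q + N.a q * N.a₂ q) / (1 - N.a q) - 2 * N.a₂ q) / N.a q]

theorem jetMatrix₁_smooth (i j : Fin 3) : ContDiffOn ℝ ∞ (fun q => N.jetMatrix₁ q i j) U := by
  have ha := N.a_smooth
  have h1 := N.a₁_smooth
  have h2 := N.a₂_smooth
  have h12 := N.a₁₂_smooth
  have hK := N.K_smooth
  have hne := fun q (hq : q ∈ U) => N.one_sub_a_ne_zero hq
  fin_cases i <;> fin_cases j
  · exact contDiffOn_const
  · exact h2.neg
  · exact ha.neg
  · exact contDiffOn_const
  · exact h2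
  · exact ha
  · exact hK.neg.div (contDiffOn_const.sub ha) hne
  · exact ((h12.add (h2.pow 2)).sub hK).div (contDiffOn_const.sub ha) hne
  · exact (h1.add (ha.mul h2)).div (contDiffOn_const.sub ha) hne

theorem jetMatrix₂_smooth (i j : Fin 3) : ContDiffOn ℝ ∞ (fun q => N.jetMatrix₂ q i j) U := by
  have ha := N.a_smooth
  have h2 := N.a₂_smooth
  have h22 := N.a₂₂_smooth
  have hK := N.K_smooth
  have hne := fun q (hq : q ∈ U) => N.a_ne_zero hq
  have hJ := fun j => N.jetMatrix₁_smooth 2 j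
  fin_cases i <;> fin_cases j
  · exact contDiffOn_const
  · exact h2.neg
  · exact ha.neg
  · exact contDiffOn_const
  · exact contDiffOn_const
  · exact contDiffOn_const
  · exact (hJ 0).div ha hne
  · exact (((hJ 1).add hK).sub h22).div ha hne
  · exact ((hJ 2).sub (contDiffOn_const.mul h2)).div ha hne

theorem sum_jetMatrix₁ (Z : Plane → Fin 3 → ℝ) (j : Fin 3) :
    (fun z => ∑ m, N.jetMatrix₁ z j m * Z z m) =
      ![N.commonDerivative (fun z => Z z 1) (fun z => Z z 2),
        fun z => -N.commonDerivative (fun z => Z z 1) (fun z => Z z 2) z,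
        N.jetδ₁ (fun z => Z z 0) (fun z => Z z 1) (fun z => Z z 2)] j := by
  funext z
  fin_cases j
  · simp [Fin.sum_univ_three, jetMatrix₁, commonDerivative]
  · simp [Fin.sum_univ_three, jetMatrix₁, commonDerivative, add_comm]
  · simp [Fin.sum_univ_three, jetMatrix₁, jetδ₁]
    ring

theorem sum_jetMatrix₂ (Z : Plane → Fin 3 → ℝ) (j : Fin 3) :
    (fun z => ∑ m, N.jetMatrix₂ z j m * Z z m) =
      ![N.commonDerivative (fun z => Z z 1) (fun z => Z z 2), fun z => Z z 2,
        N.jetδ₂ (fun z => Z z 0) (fun z => Z z 1) (fun z => Z z 2)] j := by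
  funext z
  fin_cases j
  · exact congrFun (N.sum_jetMatrix₁ Z 0) z
  · simp [Fin.sum_univ_three, jetMatrix₂]
  · simp [Fin.sum_univ_three, jetMatrix₂, jetδ₁, jetδ₂]
    ring

theorem systemAt_jetMatrix_iff {Z : Plane → Fin 3 → ℝ} {q : Plane} :
    N.SystemAt ![1, 1, 2] N.jetMatrix₁ N.jetMatrix₂ Z q ↔
      N.JetSolvesAt (fun z => Z z 0) (fun z => Z z 1) (fun z => Z z 2) q := by
  have e1 := fun j => congrFun (N.sum_jetMatrix₁ Z j) q
  have e2 := fun j => congrFun (N.sum_jetMatrix₂ Z j) q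
  unfold SystemAt
  rw [differentiableAt_pi]
  constructor
  · rintro ⟨hd, h⟩
    exact ⟨⟨hd 0, (h 0).1.trans (e1 0), (h 0).2.trans (e2 0)⟩,
      ⟨hd 1, (h 1).1.trans (e1 1), (h 1).2.trans (e2 1)⟩,
      ⟨hd 2, (h 2).1.trans (e1 2), (h 2).2.trans (e2 2)⟩⟩
  · rintro ⟨h0, h1, h2⟩
    refine ⟨fun j => ?_, fun j => ?_⟩
    · fin_cases j
      exacts [h0.1, h1.1, h2.1]
    · fin_cases j
      exacts [⟨h0.2.1.trans (e1 0).symm, h0.2.2.trans (e2 0).symm⟩,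
        ⟨h1.2.1.trans (e1 1).symm, h1.2.2.trans (e2 1).symm⟩,
        ⟨h2.2.1.trans (e1 2).symm, h2.2.2.trans (e2 2).symm⟩]

/-- A solution of the abelian equation on a convex open set whose `1`-jet vanishes at a point
vanishes. -/
theorem eq_zero_of_jet_eq_zero {u v : Plane → ℝ} {V : Set Plane} (hV : IsOpen V) (hVU : V ⊆ U)
    (hVc : Convex ℝ V) (hu : ContDiffOn ℝ ∞ u V) (hv : ContDiffOn ℝ ∞ v V)
    (h : IsAbelianOn N.η (N.multipliers u v) V) {q : Plane} (hq : q ∈ V) (h0 : u q = 0)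
    (h1 : v q = 0) (h2 : N.δ₂ 1 v q = 0) : ∀ z ∈ V, u z = 0 ∧ v z = 0 := by
  have hZ := N.eq_zero_of_systemAt ![1, 1, 2] N.jetMatrix₁ N.jetMatrix₂ hVc hVU
    (fun i j => (N.jetMatrix₁_smooth i j).mono hVU) (fun i j => (N.jetMatrix₂_smooth i j).mono hVU)
    (Z := fun z => ![u z, v z, N.δ₂ 1 v z])
    (fun z hz => N.systemAt_jetMatrix_iff.2 (jetSolvesAt_of_isAbelianOn hV hVU hu hv h hz)) hq
    (by funext i; fin_cases i <;> simp [h0, h1, h2])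
  intro z hz
  exact ⟨congrFun (hZ z hz) 0, congrFun (hZ z hz) 1⟩

/-- If the rank is at least two, there are two solutions of the abelian equation near the point
whose jets are independent everywhere. -/
theorem exists_independent_solutions {p : Plane} (hp : p ∈ U) (hr : 2 ≤ W.rankAt p hp) :
    ∃ (u v : Fin 2 → Plane → ℝ) (V : Set Plane), IsOpen V ∧ p ∈ V ∧ V ⊆ U ∧
      (∀ i, ContDiffOn ℝ ∞ (u i) V) ∧ (∀ i, ContDiffOn ℝ ∞ (v i) V) ∧
      (∀ i, IsAbelianOn N.η (N.multipliers (u i) (v i)) V) ∧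
      ∀ q ∈ V, ∀ s t : ℝ, s * u 0 q + t * u 1 q = 0 → s * v 0 q + t * v 1 q = 0 →
        s * N.δ₂ 1 (v 0) q + t * N.δ₂ 1 (v 1) q = 0 → s = 0 ∧ t = 0 := by
  have h1 : 1 < Module.rank ℝ (W.abelianGerms p hp) := lt_of_lt_of_le (by norm_num) hr
  obtain ⟨x, hx⟩ := rank_pos_iff_exists_ne_zero.1 (zero_lt_one.trans h1)
  obtain ⟨y, hxy⟩ := exists_linearIndependent_pair_of_one_lt_rank h1 hx
  choose u v V hV hpV hVU hu hv hab hφ using fun i : Fin 2 =>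
    N.exists_formMultipliers_of_mem_abelianGerms (![x, y] i).2
  -- A ball is convex, so a combination whose jet vanishes at any point of it vanishes throughout,
  -- in particular as a germ at `p`; this contradicts independence of the germs unless the
  -- coefficients are zero.
  obtain ⟨r, hr, hrV⟩ := Metric.isOpen_iff.1 ((hV 0).inter (hV 1)) p ⟨hpV 0, hpV 1⟩
  have hBV : ∀ i, Metric.ball p r ⊆ V i := fun i => by
    fin_cases i
    exacts [hrV.trans Set.inter_subset_left, hrV.trans Set.inter_subset_right]
  have hpB := Metric.mem_ball_self (x := p) hr
  have hBU := (hBV 0).trans (hVU 0)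
  have hu' := fun i => (hu i).mono (hBV i)
  have hv' := fun i => (hv i).mono (hBV i)
  have hab' : ∀ i, IsAbelianOn N.η (N.multipliers (u i) (v i)) (Metric.ball p r) := fun i =>
    ⟨(hab i).1.mono (hBV i), fun q hq => (hab i).2 q (hBV i hq)⟩
  refine ⟨u, v, Metric.ball p r, Metric.isOpen_ball, hpB, hBU, hu', hv', hab',
    fun q hq s t e0 e1 e2 => ?_⟩
  let g : Fin 2 → ℝ := ![s, t]
  have hcv := HasCovAt.sum_mul g fun i =>
    N.hasCovAt_of_smooth Metric.isOpen_ball (hv' i) 1 hq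
  have hz := N.eq_zero_of_jet_eq_zero Metric.isOpen_ball hBU (convex_ball p r)
    (ContDiffOn.sum fun i _ => contDiffOn_const.mul (hu' i))
    (ContDiffOn.sum fun i _ => contDiffOn_const.mul (hv' i))
    (isAbelianOn_sum Metric.isOpen_ball hBU hu' hv' hab' g) hq
    (by simpa [Fin.sum_univ_two, g] using e0) (by simpa [Fin.sum_univ_two, g] using e1)
    (by rw [hcv.2.2]; simpa [Fin.sum_univ_two, g] using e2)
  have hB := Metric.isOpen_ball.mem_nhds hpB
  have h0 := (sum_smul_germ_formMultipliers_eq_zero_iff (N := N) hp u v g).2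
    ⟨by filter_upwards [hB] with z hzB using (hz z hzB).1,
      by filter_upwards [hB] with z hzB using (hz z hzB).2⟩
  simp only [← hφ] at h0
  have h3 : ∑ i, g i • ![x, y] i = 0 := by
    apply Subtype.ext
    simpa using h0
  have h4 := Fintype.linearIndependent_iff.1 hxy g h3
  exact ⟨h4 0, h4 1⟩

section IndependentSolutions

variable {N} {u v : Fin 2 → Plane → ℝ} {V : Set Plane} (hV : IsOpen V) (hVU : V ⊆ U)
  (hu : ∀ i, ContDiffOn ℝ ∞ (u i) V) (hv : ∀ i, ContDiffOn ℝ ∞ (v i) V)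
  (hab : ∀ i, IsAbelianOn N.η (N.multipliers (u i) (v i)) V) {q : Plane} (hq : q ∈ V)
  (hind : ∀ s t : ℝ, s * u 0 q + t * u 1 q = 0 → s * v 0 q + t * v 1 q = 0 →
        s * N.δ₂ 1 (v 0) q + t * N.δ₂ 1 (v 1) q = 0 → s = 0 ∧ t = 0)
include hV hVU hu hv hab hq hind

/-- Comparing the commutator of the first-order system with the curvature shows that the
compatibility matrix kills `(u, v)` of each solution. Two such vectors are independent, because `c₀
≠ 0` makes `w` a function of `u` and `v`. -/
theorem compat_eq_zero_of_independent (h0 : N.c₀ q ≠ 0) : N.compat q = 0 := by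
  have ho := fun i => obstruction_eq_zero hV hVU (hu i) (hv i) (hab i) hq
  have hcross : u 0 q * v 1 q - u 1 q * v 0 q ≠ 0 := by
    refine cross_ne_zero_of_independent (x := fun i => u i q) (y := fun i => v i q)
      fun s t e0 e1 => hind s t e0 e1 ?_
    refine (mul_eq_zero.1 ?_).resolve_left h0
    linear_combination s * ho 0 + t * ho 1 - N.c₁ q * e1 - N.c₂ q * e0
  let V' := V ∩ {z | N.c₀ z ≠ 0}
  have hV' : V' ∈ 𝓝 q := Filter.inter_mem (hV.mem_nhds hq)
    ((N.c₀_smooth.continuousOn.continuousAt (W.isOpen.mem_nhds (hVU hq))).eventually_ne h0)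
  obtain ⟨O, hOV', hO, hqO⟩ := mem_nhds_iff.1 hV'
  have hOV : O ⊆ V := fun z hz => (hOV' hz).1
  have hsolve : ∀ i, ∀ z ∈ O, N.SolvesAt (u i) (v i) z := fun i =>
    (N.isAbelianOn_iff_solvesAt hO (hOV.trans hVU) (fun z hz => (hOV' hz).2)
      ((hu i).mono hOV) ((hv i).mono hOV)).1
      ⟨(hab i).1.mono hOV, fun z hz => (hab i).2 z (hOV hz)⟩
  have key : ∀ i j, N.compat q j 0 * u i q + N.compat q j 1 * v i q = 0 := by
    intro i j
    have hc := N.comm_eq_compat (hVU hq) h0 ((hu i).differentiableAt_of_isOpen hV hq)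
      ((hv i).differentiableAt_of_isOpen hV hq) (hsolve i q hqO) j
    have hev : ∀ᶠ z in 𝓝 q, N.SolvesAt (u i) (v i) z := by
      filter_upwards [hO.mem_nhds hqO] with z hz using hsolve i z hz
    have hcong : ∀ {f g : Plane → ℝ}, f =ᶠ[𝓝 q] g →
        N.δ₁ 2 f q = N.δ₁ 2 g q ∧ N.δ₂ 2 f q = N.δ₂ 2 g q := fun h => by
      simp only [δ₁, δ₂, h.fderiv_eq, h.eq_of_nhds, and_self]
    fin_cases j
    · have hw := N.δ_comm hV hVU (hu i) 1 hq
      rw [Nat.cast_one, one_mul, show 1 + 1 = 2 from rfl,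
        (hcong (hev.mono fun z hz => hz.1)).2, (hcong (hev.mono fun z hz => hz.2.1)).1] at hw
      simp only [Fin.zero_eta, Matrix.cons_val_zero] at hc ⊢
      linarith
    · have hw := N.δ_comm hV hVU (hv i) 1 hq
      rw [Nat.cast_one, one_mul, show 1 + 1 = 2 from rfl,
        (hcong (hev.mono fun z hz => hz.2.2.1)).2,
        (hcong (hev.mono fun z hz => hz.2.2.2)).1] at hw
      simp only [Fin.mk_one, Matrix.cons_val_one, Matrix.cons_val_fin_one] at hc ⊢
      linarith
  ext j m
  have h2 := eq_zero_of_cross_ne_zero (x := fun i => u i q) (y := fun i => v i q) hcross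
    (fun i => key i j)
  fin_cases m
  exacts [h2.1, h2.2]

/-- The obstruction is now the single relation `c₁ v + c₂ u = 0`. Either `(u, v)` of the two
solutions are independent, and it forces `c₁ = c₂ = 0`, or some combination has `u = v = 0` and `w ≠
0` at `q`, and the derivatives of the relation do. -/
theorem c₁_c₂_eq_zero_of_independent (h0 : ∀ᶠ z in 𝓝 q, N.c₀ z = 0) :
    N.c₁ q = 0 ∧ N.c₂ q = 0 := by
  have hqU := hVU hq
  have hF : ∀ i, (fun _ => (0 : ℝ)) =ᶠ[𝓝 q] fun z => N.c₁ z * v i z + N.c₂ z * u i z := by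
    intro i
    filter_upwards [h0, hV.mem_nhds hq] with z hz hzV
    have := obstruction_eq_zero hV hVU (hu i) (hv i) (hab i) hzV
    rw [hz] at this
    linarith
  have hd := fun i => by
    have hj := jetSolvesAt_of_isAbelianOn hV hVU (hu i) (hv i) (hab i) hq
    have h4 : N.HasCovAt 4 (fun _ => (0 : ℝ)) _ _ q :=
      (((N.cov_c₁ hqU).mul hj.2.1).add ((N.cov_c₂ hqU).mul hj.1)).congr_of_eventuallyEq (hF i)
    have e1 : N.δ₁ 4 (fun _ => (0 : ℝ)) q = 0 := by simp [δ₁]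
    have e2 : N.δ₂ 4 (fun _ => (0 : ℝ)) q = 0 := by simp [δ₂]
    exact And.intro (h4.2.1.symm.trans e1) (h4.2.2.symm.trans e2)
  have hF0 := fun i => (hF i).eq_of_nhds
  simp only [commonDerivative] at hF0 hd
  by_contra hne
  have hcross : u 0 q * v 1 q - u 1 q * v 0 q ≠ 0 := by
    refine cross_ne_zero_of_independent (x := fun i => u i q) (y := fun i => v i q)
      fun s t e0 e1 => hind s t e0 e1 ?_
    by_contra hw
    -- Where the combination has `u = v = 0`, the derivatives of the relation reduce to `a (c₁ - c₂)
    -- w = 0` and `(c₁ - a c₂) w = 0`; as `a ≠ 0, 1`, these two force `c₁ = c₂ = 0` when `w ≠ 0`.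
    have k1 : N.a q * (N.c₁ q - N.c₂ q) = 0 := by
      refine (mul_eq_zero.1 ?_).resolve_right hw
      linear_combination s * (hd 0).1 + t * (hd 1).1 - N.c₁₁ q * e1 - N.c₂₁ q * e0
        - N.a₂ q * (N.c₁ q - N.c₂ q) * e1
    have k2 : N.c₁ q - N.a q * N.c₂ q = 0 := by
      refine (mul_eq_zero.1 ?_).resolve_right hw
      linear_combination s * (hd 0).2 + t * (hd 1).2 - N.c₁₂ q * e1 - N.c₂₂ q * e0
        + N.a₂ q * N.c₂ q * e1
    have k3 := (mul_eq_zero.1 k1).resolve_left (N.a_ne_zero hqU)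
    have k4 : N.c₂ q = 0 := by
      refine (mul_eq_zero.1 ?_).resolve_left (N.one_sub_a_ne_zero hqU)
      linear_combination k2 - k3
    exact hne ⟨by linarith, k4⟩
  have h3 := eq_zero_of_cross_ne_zero (x := fun i => u i q) (y := fun i => v i q) hcross
    (r := N.c₂ q) (s := N.c₁ q) (fun i => by linarith [hF0 i])
  exact hne h3.symm

end IndependentSolutions

end FourWeb.Normalization

/-! ### Vanishing of the `G` invariants and bounds on the rank. -/

namespace FourWeb.Normalization

variable {U : Set Plane} {W : FourWeb U} (N : W.Normalization)

theorem continuousOn_G : ContinuousOn N.G₁₁ U ∧ ContinuousOn N.G₁₂ U ∧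
    ContinuousOn N.G₂₁ U ∧ ContinuousOn N.G₂₂ U := by
  have ha := N.a_smooth.continuousOn
  have h1 := N.a₁_smooth.continuousOn
  have h2 := N.a₂_smooth.continuousOn
  have h12 := N.a₁₂_smooth.continuousOn
  have h22 := N.a₂₂_smooth.continuousOn
  have hK := N.K_smooth.continuousOn
  have hc0 := N.c₀_smooth.continuousOn
  have hc1 := N.c₁_smooth.continuousOn
  have hc2 := N.c₂_smooth.continuousOn
  have hc01 : ContinuousOn N.c₀₁ U := (N.δ_smooth 2 N.c₀_smooth).1.continuousOn
  have hc02 : ContinuousOn N.c₀₂ U := (N.δ_smooth 2 N.c₀_smooth).2.continuousOn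
  have hc11 : ContinuousOn N.c₁₁ U := (N.δ_smooth 3 N.c₁_smooth).1.continuousOn
  have hc12 : ContinuousOn N.c₁₂ U := (N.δ_smooth 3 N.c₁_smooth).2.continuousOn
  have hc21 : ContinuousOn N.c₂₁ U := (N.δ_smooth 3 N.c₂_smooth).1.continuousOn
  have hc22 : ContinuousOn N.c₂₂ U := (N.δ_smooth 3 N.c₂_smooth).2.continuousOn
  refine ⟨?_, ?_, ?_, ?_⟩
  · unfold G₁₁
    dsimp only
    fun_prop
  · unfold G₁₂
    dsimp only
    fun_prop
  · unfold G₂₁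
    dsimp only
    fun_prop
  · unfold G₂₂
    dsimp only
    fun_prop

theorem gVanish_of_frequently {q : Plane} (hq : q ∈ U) (h : ∃ᶠ z in 𝓝 q, N.GVanish z) :
    N.GVanish q := by
  obtain ⟨h1, h2, h3, h4⟩ := N.continuousOn_G
  have key : ∀ G : Plane → ℝ, ContinuousOn G U → (∃ᶠ z in 𝓝 q, G z = 0) → G q = 0 :=
    fun G hG hf => isClosed_singleton.mem_of_frequently_of_tendsto hf
      (hG.continuousAt (W.isOpen.mem_nhds hq))
  exact ⟨key _ h1 (h.mono fun z hz => hz.1), key _ h2 (h.mono fun z hz => hz.2.1),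
    key _ h3 (h.mono fun z hz => hz.2.2.1), key _ h4 (h.mono fun z hz => hz.2.2.2)⟩

theorem compat_eq_zero_iff {q : Plane} (hq : q ∈ U) (h0 : N.c₀ q ≠ 0) :
    N.compat q = 0 ↔ N.GVanish q := by
  have h := N.sq_smul_compat hq h0
  constructor
  · intro hc
    rw [hc, smul_zero] at h
    exact ⟨(congrFun₂ h 0 0).symm, (congrFun₂ h 0 1).symm, (congrFun₂ h 1 0).symm,
      (congrFun₂ h 1 1).symm⟩
  · rintro ⟨h1, h2, h3, h4⟩
    rw [h1, h2, h3, h4] at h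
    refine (smul_eq_zero.1 (h.trans ?_)).resolve_left (pow_ne_zero 2 h0)
    ext i j
    fin_cases i <;> fin_cases j <;> rfl

theorem eventually_gVanish_of_two_le_rankAt {p : Plane} (hp : p ∈ U)
    (hr : 2 ≤ W.rankAt p hp) : ∀ᶠ q in 𝓝 p, N.GVanish q := by
  obtain ⟨u, v, V, hV, hpV, hVU, hu, hv, hab, hind⟩ := N.exists_independent_solutions hp hr
  have hG : ∀ q ∈ V, N.c₀ q ≠ 0 → N.GVanish q := fun q hq h0 =>
    (N.compat_eq_zero_iff (hVU hq) h0).1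
      (compat_eq_zero_of_independent hV hVU hu hv hab hq (hind q hq) h0)
  -- Either `c₀` vanishes near `q`, and then all `cᵢ` vanish at `q`, or `q` is a limit of points
  -- with `c₀ ≠ 0`, and continuity applies.
  filter_upwards [hV.mem_nhds hpV] with q hq
  by_cases hz : ∀ᶠ z in 𝓝 q, N.c₀ z = 0
  · obtain ⟨h1, h2⟩ := c₁_c₂_eq_zero_of_independent hV hVU hu hv hab hq (hind q hq) hz
    have h0 : N.c₀ q = 0 := hz.self_of_nhds
    refine ⟨?_, ?_, ?_, ?_⟩ <;> simp [G₁₁, G₁₂, G₂₁, G₂₂, h0, h1, h2]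
  · refine N.gVanish_of_frequently (hVU hq) ?_
    exact ((not_eventually.1 hz).and_eventually (hV.mem_nhds hq)).mono fun z hzz =>
      hG z hzz.2 hzz.1

/-- With the obstruction gone the prolonged system is flat, so `(u, v, w)` can be prescribed
arbitrarily at `p`. -/
theorem three_le_rankAt {p : Plane} (hp : p ∈ U)
    (h : ∀ᶠ q in 𝓝 p, N.c₀ q = 0 ∧ N.c₁ q = 0 ∧ N.c₂ q = 0) : 3 ≤ W.rankAt p hp := by
  obtain ⟨V, hVs, hV, hpV⟩ := mem_nhds_iff.1 (h.and (W.isOpen.mem_nhds hp))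
  have hVU : V ⊆ U := fun q hq => (hVs hq).2
  have hflat : ∀ q ∈ V, ∀ Z, N.SystemAt ![1, 1, 2] N.jetMatrix₁ N.jetMatrix₂ Z q → ∀ j,
      N.δ₂ ((![1, 1, 2] : Fin 3 → ℕ) j + 1) (fun z => ∑ m, N.jetMatrix₁ z j m * Z z m) q
        - N.δ₁ ((![1, 1, 2] : Fin 3 → ℕ) j + 1) (fun z => ∑ m, N.jetMatrix₂ z j m * Z z m) q
        = ((![1, 1, 2] : Fin 3 → ℕ) j : ℝ) * N.K q * Z q j := by
    intro q hq Z hZ j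
    have hj := N.systemAt_jetMatrix_iff.1 hZ
    rw [N.sum_jetMatrix₁, N.sum_jetMatrix₂]
    fin_cases j
    · simpa using N.jet_comm_u (hVU hq) hj
    · simpa using N.jet_comm_v (hVU hq) hj
    · have := N.jet_comm_w (hVU hq) hj
      obtain ⟨⟨h0, h1, h2⟩, -⟩ := hVs hq
      rw [h0, h1, h2] at this
      simpa using this
  choose Z O hO hpO hOV hZp hZs hZ using fun i : Fin 3 =>
    N.exists_systemAt ![1, 1, 2] N.jetMatrix₁ N.jetMatrix₂ hV hVU
      (fun i j => (N.jetMatrix₁_smooth i j).mono hVU)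
      (fun i j => (N.jetMatrix₂_smooth i j).mono hVU) hflat hpV (Pi.single i 1)
  have hOU := fun i => (hOV i).trans hVU
  have hs := fun i j => contDiffOn_pi.1 (hZs i) j
  have hjet := fun i q (hq : q ∈ O i) => N.systemAt_jetMatrix_iff.1 (hZ i q hq)
  refine N.le_rankAt (n := 3) hp (fun i z => Z i z 0) (fun i z => Z i z 1) O hO hOU hpO
    (fun i => ?_) fun g h0 h1 => ?_
  · rw [N.isAbelianOn_multipliers_iff (hO i) (hOU i) (hs i 0) (hs i 1)]
    intro q hq
    obtain ⟨hu, hv, -⟩ := hjet i q hq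
    simp only [commonDerivative] at hu hv ⊢
    rw [hv.2.2]
    exact ⟨hu.2.1, hu.2.2, hv.2.1⟩
  -- Germs record only `u` and `v`; the third coordinate of the initial values is recovered as `δ₂`
  -- of the combination of the `v`s.
  · have hc := (HasCovAt.sum_mul g fun i => (hjet i p (hpO i)).2.1).2.2
    have h2 : N.δ₂ 1 (fun z => ∑ i, g i * Z i z 1) p = 0 := by
      have h1' : (fun z => ∑ i, g i * Z i z 1) =ᶠ[𝓝 p] fun _ => 0 := h1
      simp only [δ₂, h1'.fderiv_eq, h1'.eq_of_nhds]
      simp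
    rw [h2] at hc
    have e0 := h0.self_of_nhds
    have e1 := h1.self_of_nhds
    simp only [hZp] at e0 e1 hc
    funext i
    fin_cases i
    · simpa [Fin.sum_univ_three] using e0
    · simpa [Fin.sum_univ_three] using e1
    · simpa [Fin.sum_univ_three] using hc.symm

/-- If `c₀` vanished near `p`, two independent solutions would make `c₁` and `c₂` vanish too, and
the rank would jump to at least three. -/
theorem frequently_c₀_ne_zero_of_rankAt_eq_two {p : Plane} (hp : p ∈ U)
    (hr : W.rankAt p hp = 2) : ∃ᶠ q in 𝓝 p, N.c₀ q ≠ 0 := by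
  obtain ⟨u, v, V, hV, hpV, hVU, hu, hv, hab, hind⟩ := N.exists_independent_solutions hp hr.ge
  intro h
  simp only [not_not] at h
  have h3 := N.three_le_rankAt hp (by
    filter_upwards [h.eventually_nhds, hV.mem_nhds hpV] with q hq hqV
    exact ⟨hq.self_of_nhds,
      c₁_c₂_eq_zero_of_independent hV hVU hu hv hab hqV (hind q hqV) hq⟩)
  rw [hr] at h3
  exact absurd h3 (by norm_num)

section FirstOrderSystem

theorem systemAt_M_iff {Z : Plane → Fin 2 → ℝ} {q : Plane} :
    N.SystemAt ![1, 1] N.M₁ N.M₂ Z q ↔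
      DifferentiableAt ℝ Z q ∧ N.SolvesAt (fun z => Z z 0) (fun z => Z z 1) q := by
  unfold SystemAt SolvesAt
  refine and_congr_right fun _ => ?_
  rw [Fin.forall_fin_two]
  simp only [Fin.sum_univ_two, Matrix.cons_val_zero, Matrix.cons_val_one,
    Matrix.cons_val_fin_one]
  tauto

variable {V : Set Plane} (hVU : V ⊆ U) (h0 : ∀ q ∈ V, N.c₀ q ≠ 0)
include hVU h0

theorem M₁_smooth (i j : Fin 2) : ContDiffOn ℝ ∞ (fun q => N.M₁ q i j) V := by
  have ha := N.a_smooth.mono hVU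
  have h2 := N.a₂_smooth.mono hVU
  have hc0 := N.c₀_smooth.mono hVU
  have hc1 := N.c₁_smooth.mono hVU
  have hc2 := N.c₂_smooth.mono hVU
  fin_cases i <;> fin_cases j
  exacts [(ha.mul hc2).div hc0 h0, ((ha.mul hc1).sub (h2.mul hc0)).div hc0 h0,
    ((ha.mul hc2).div hc0 h0).neg, ((h2.mul hc0).sub (ha.mul hc1)).div hc0 h0]

theorem M₂_smooth (i j : Fin 2) : ContDiffOn ℝ ∞ (fun q => N.M₂ q i j) V := by
  have hc0 := N.c₀_smooth.mono hVU
  have hc1 := N.c₁_smooth.mono hVU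
  have hc2 := N.c₂_smooth.mono hVU
  fin_cases i <;> fin_cases j
  exacts [N.M₁_smooth hVU h0 0 0, N.M₁_smooth hVU h0 0 1, (hc2.div hc0 h0).neg,
    (hc1.div hc0 h0).neg]

end FirstOrderSystem

/-- Uniqueness for the first-order system makes evaluation at `p` injective; no flatness is needed.
-/
theorem rankAt_le_two {p : Plane} (hp : p ∈ U) (h0 : N.c₀ p ≠ 0) : W.rankAt p hp ≤ 2 := by
  -- The indices 2 and 3 pick the multipliers that equal `u` and `v` up to nonzero scales.
  let ev : W.abelianGerms p hp →ₗ[ℝ] Fin 2 → ℝ :=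
    (LinearMap.funLeft ℝ ℝ ![2, 3]).comp
      ((Germ.valueₗ (𝕜 := ℝ) (E := Fin 4 → ℝ) (x := p)).comp (W.abelianGerms p hp).subtype)
  have hev : Function.Injective ev := by
    rw [← LinearMap.ker_eq_bot, LinearMap.ker_eq_bot']
    rintro ⟨φ, hφ⟩ hz
    obtain ⟨u, v, V, hV, hpV, hVU, hu, hv, hab, rfl⟩ :=
      N.exists_formMultipliers_of_mem_abelianGerms hφ
    have hz0 : N.scale 2 p * u p = 0 := congrFun hz 0
    have hz1 : N.scale 3 p * v p = 0 := congrFun hz 1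
    have hne : ∀ᶠ z in 𝓝 p, N.c₀ z ≠ 0 :=
      (N.c₀_smooth.continuousOn.continuousAt (W.isOpen.mem_nhds hp)).eventually_ne h0
    obtain ⟨r, hr, hB⟩ := Metric.mem_nhds_iff.1 (hne.and (hV.mem_nhds hpV))
    have hBV : Metric.ball p r ⊆ V := fun z hz => (hB hz).2
    have hBU := hBV.trans hVU
    have hB0 : ∀ z ∈ Metric.ball p r, N.c₀ z ≠ 0 := fun z hz => (hB hz).1
    have hpB := Metric.mem_ball_self (x := p) hr
    have hu' := hu.mono hBV
    have hv' := hv.mono hBV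
    have hsol := (N.isAbelianOn_iff_solvesAt Metric.isOpen_ball hBU hB0 hu' hv').1
      ⟨hab.1.mono hBV, fun q hq => hab.2 q (hBV hq)⟩
    have hZ := N.eq_zero_of_systemAt ![1, 1] N.M₁ N.M₂ (convex_ball p r) hBU
      (N.M₁_smooth hBU hB0) (N.M₂_smooth hBU hB0) (Z := fun z => ![u z, v z])
      (fun q hq => N.systemAt_M_iff.2 ⟨differentiableAt_pi.2 fun i => by
        fin_cases i
        exacts [hu'.differentiableAt_of_isOpen Metric.isOpen_ball hq,
          hv'.differentiableAt_of_isOpen Metric.isOpen_ball hq], hsol q hq⟩) hpB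
      (by
        funext i
        fin_cases i
        exacts [(mul_eq_zero.1 hz0).resolve_left (N.scale_ne_zero 2 p hp),
          (mul_eq_zero.1 hz1).resolve_left (N.scale_ne_zero 3 p hp)])
    apply Subtype.ext
    change ((N.formMultipliers u v : Plane → Fin 4 → ℝ) : Germ (𝓝 p) (Fin 4 → ℝ)) = 0
    rw [← Germ.coe_zero, Germ.coe_eq]
    filter_upwards [Metric.isOpen_ball.mem_nhds hpB] with z hz
    have e0 : u z = 0 := congrFun (hZ z hz) 0
    have e1 : v z = 0 := congrFun (hZ z hz) 1
    funext i
    simp only [formMultipliers, multipliers, e0, e1, Pi.zero_apply]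
    fin_cases i <;> simp
  have h := LinearMap.rank_le_of_injective ev hev
  rw [rank_fin_fun] at h
  exact h

/-- Vanishing of the `G` invariants is flatness of the first-order system near `p`, so the two unit
initial values extend to solutions. -/
theorem two_le_rankAt {p : Plane} (hp : p ∈ U) (h0 : N.c₀ p ≠ 0)
    (hG : ∀ᶠ q in 𝓝 p, N.GVanish q) : 2 ≤ W.rankAt p hp := by
  have hne : ∀ᶠ z in 𝓝 p, N.c₀ z ≠ 0 :=
    (N.c₀_smooth.continuousOn.continuousAt (W.isOpen.mem_nhds hp)).eventually_ne h0
  obtain ⟨V, hVs, hV, hpV⟩ := mem_nhds_iff.1 ((hne.and hG).and (W.isOpen.mem_nhds hp))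
  have hVU : V ⊆ U := fun q hq => (hVs hq).2
  have hV0 : ∀ q ∈ V, N.c₀ q ≠ 0 := fun q hq => (hVs hq).1.1
  have hflat : ∀ q ∈ V, ∀ Z, N.SystemAt ![1, 1] N.M₁ N.M₂ Z q → ∀ j,
      N.δ₂ ((![1, 1] : Fin 2 → ℕ) j + 1) (fun z => ∑ m, N.M₁ z j m * Z z m) q
        - N.δ₁ ((![1, 1] : Fin 2 → ℕ) j + 1) (fun z => ∑ m, N.M₂ z j m * Z z m) q
        = ((![1, 1] : Fin 2 → ℕ) j : ℝ) * N.K q * Z q j := by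
    intro q hq Z hZ j
    obtain ⟨hd, hs⟩ := N.systemAt_M_iff.1 hZ
    have hc := N.comm_eq_compat (hVU hq) (hV0 q hq) (differentiableAt_pi.1 hd 0)
      (differentiableAt_pi.1 hd 1) hs j
    rw [(N.compat_eq_zero_iff (hVU hq) (hV0 q hq)).2 (hVs hq).1.2] at hc
    simp only [Fin.sum_univ_two]
    fin_cases j
    · simpa using hc
    · simpa using hc
  choose Z O hO hpO hOV hZp hZs hZ using fun i : Fin 2 =>
    N.exists_systemAt ![1, 1] N.M₁ N.M₂ hV hVU (N.M₁_smooth hVU hV0) (N.M₂_smooth hVU hV0)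
      hflat hpV (Pi.single i 1)
  have hs := fun i j => contDiffOn_pi.1 (hZs i) j
  refine N.le_rankAt (n := 2) hp (fun i z => Z i z 0) (fun i z => Z i z 1) O hO
    (fun i => (hOV i).trans hVU) hpO (fun i => ?_) fun g e0 e1 => ?_
  · exact (N.isAbelianOn_iff_solvesAt (hO i) ((hOV i).trans hVU)
      (fun q hq => hV0 q (hOV i hq)) (hs i 0) (hs i 1)).2
      fun q hq => (N.systemAt_M_iff.1 (hZ i q hq)).2
  · have e0 := e0.self_of_nhds
    have e1 := e1.self_of_nhds
    simp only [hZp] at e0 e1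
    funext i
    fin_cases i
    · simpa [Fin.sum_univ_two] using e0
    · simpa [Fin.sum_univ_two] using e1

end FourWeb.Normalization

/-! ### Assembly of the rank criterion. -/

theorem theorem5 {U : Set Plane} (W : FourWeb U) (N : W.Normalization) (p : Plane) (hp : p ∈ U) :
    -- the criterion: the case distinction is `c₀ ≠ 0` against `c₀` vanishing identically
    ((N.c₀ p ≠ 0 ∨ ∀ᶠ q in 𝓝 p, N.c₀ q = 0) →
      (W.rankAt p hp = 2 ↔ N.c₀ p ≠ 0 ∧ ∀ᶠ q in 𝓝 p, N.GVanish q)) ∧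
    -- necessity, without any assumption on the zeros of `c₀`
    (W.rankAt p hp = 2 → (∃ᶠ q in 𝓝 p, N.c₀ q ≠ 0) ∧ ∀ᶠ q in 𝓝 p, N.GVanish q) ∧
    -- where `c₀ ≠ 0`, the abelian equation is the first-order system solved for `u₁, u₂, v₁, v₂`
    (∀ V : Set Plane, IsOpen V → V ⊆ U → (∀ q ∈ V, N.c₀ q ≠ 0) →
      ∀ u v : Plane → ℝ, ContDiffOn ℝ ∞ u V → ContDiffOn ℝ ∞ v V →
        (IsAbelianOn N.η (N.multipliers u v) V ↔ ∀ q ∈ V, N.SolvesAt u v q)) ∧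
    -- and `G₁₁, G₁₂, G₂₁, G₂₂` are its compatibility conditions
    (∀ q ∈ U, N.c₀ q ≠ 0 →
      N.c₀ q ^ 2 • N.compat q = !![N.G₁₁ q, N.G₁₂ q; N.G₂₁ q, N.G₂₂ q]) := by
  have hii : W.rankAt p hp = 2 → (∃ᶠ q in 𝓝 p, N.c₀ q ≠ 0) ∧ ∀ᶠ q in 𝓝 p, N.GVanish q :=
    fun hr => ⟨N.frequently_c₀_ne_zero_of_rankAt_eq_two hp hr,
      N.eventually_gVanish_of_two_le_rankAt hp hr.ge⟩
  refine ⟨fun hc => ⟨fun hr => ⟨hc.resolve_right fun h => ?_, (hii hr).2⟩, fun h => ?_⟩, hii,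
    fun V hV hVU h0 u v hu hv => N.isAbelianOn_iff_solvesAt hV hVU h0 hu hv,
    fun q hq h0 => N.sq_smul_compat hq h0⟩
  · exact (hii hr).1 (h.mono fun q hq => not_not.2 hq)
  · exact le_antisymm (N.rankAt_le_two hp h.1) (N.two_le_rankAt hp h.1 h.2)
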